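/- Model. A dynamic radio network has a fixed set of $n$ nodes, one of them the source, and a graph $G_r$ on these nodes for each round $r\ge 1$. It is $T$-interval $k$-connected if for every $r\ge1$ the edges common to $G_r,\dots,G_{r+T-1}$ form a graph of vertex connectivity at least $k$. Each node runs a randomized process, with independent random choices in each round; in each round a node either transmits a message or listens, and a listening node receives the message of a neighbor $u$ if $u$ is its only transmitting neighbor in $G_r$, and nothing otherwise (no collision detection). Initially only the source knows the broadcast message; a node becomes informed when it first receives a message containing the broadcast message, and uninformed nodes never transmit. The graphs are chosen by a $1$-oblivious adversary: it knows the algorithm, and $G_r$ may depend on the random choices of all nodes in rounds $1,\dots,r-1$ (and on $G_1,\dots,G_{r-1}$), but not on the random choices of round $r$ or later. The broadcast time is the number of rounds until all nodes are informed. Theorem. For every constant $\varepsilon>0$ there is a constant $c>0$, depending only on $\varepsilon$, such that for all integers $n,k,T$ with $1\le k<n$ and $1\le T\le (n/k)^{1-\varepsilon}$, for every randomized distributed $n$-node algorithm and every source node, there is a $1$-oblivious adversary that always provides a $T$-interval $k$-connected network and against which the expected broadcast time of the algorithm is at least $$c\cdot\frac{n^2}{k^2\log n}.$$ -/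

import Mathlib

open MeasureTheory
open scoped ENNReal

namespace RadioBroadcast

/-- A graph on a finite vertex set has vertex connectivity at least `k`: it has more than `k`
vertices, and it stays connected whenever fewer than `k` vertices are deleted. -/
def IsVertexConnected {V : Type*} [Fintype V] (G : SimpleGraph V) (k : ℕ) : Prop :=
  k < Fintype.card V ∧
    ∀ X : Finset V, X.card < k → (G.induce {v : V | v ∉ X}).Connected

/-- A dynamic graph (the sequence of the graphs of rounds `0, 1, 2, …`) is `T`-interval
`k`-connected if, for all `r`, the edges that are present in all of the `T` consecutive rounds
`r, …, r + T - 1` form a graph of vertex connectivity at least `k`. -/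
def IsIntervalConnected {V : Type*} [Fintype V] (G : ℕ → SimpleGraph V) (T k : ℕ) : Prop :=
  ∀ r : ℕ, IsVertexConnected (⨅ i ∈ Set.Ico r (r + T), G i) k

/-- An `n`-node randomized distributed algorithm: one randomized process for each node `u`.
A process has states in `S`, draws one random choice in `C` in each round, and sends messages
in `M`. In round `r` it decides from its state and its random choice of round `r` whether to
transmit and what to transmit; its next state depends on its state, its random choice, and on
what it received in that round (one message, or nothing). Processes know their name `u` and
the round number `r`. -/
structure Algorithm (n : ℕ) (S C M : Type*)
    [MeasurableSpace S] [MeasurableSpace C] [MeasurableSpace M] where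
  /-- the initial state of each process -/
  init : Fin n → S
  /-- the distribution of the random choice that a process makes in a round -/
  law : Fin n → Measure C
  isProbabilityMeasure_law : ∀ u, IsProbabilityMeasure (law u)
  /-- the pairs (state, random choice) for which process `u`, once informed, transmits -/
  sends : Fin n → ℕ → Set (S × C)
  measurableSet_sends : ∀ u r, MeasurableSet (sends u r)
  /-- the message that is transmitted, if process `u` transmits -/
  message : Fin n → ℕ → S × C → M
  measurable_message : ∀ u r, Measurable (message u r)
  /-- the messages that contain the broadcast message -/
  payload : Set M
  measurableSet_payload : MeasurableSet payload
  /-- the next state of process `u`, if it receives a message in round `r` -/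
  onMessage : Fin n → ℕ → (S × C) × M → S
  measurable_onMessage : ∀ u r, Measurable (onMessage u r)
  /-- the next state of process `u`, if it receives nothing in round `r` -/
  onSilence : Fin n → ℕ → S × C → S
  measurable_onSilence : ∀ u r, Measurable (onSilence u r)

/-- The random choices of all nodes in all rounds: `ω r u` is the one of node `u` in round `r`. -/
abbrev Choices (n : ℕ) (C : Type*) : Type _ := ℕ → Fin n → C

/-- A `τ`-oblivious adversary. Rounds are numbered from `0`, so that the graph of round `r` (the
`(r + 1)`-st round) may depend on the random choices of the first `r + 1 - τ` rounds, that is, of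
the rounds `i` with `i + τ ≤ r`, only. (The earlier graphs are functions of these choices too.) -/
structure ObliviousAdversary (τ n : ℕ) (C : Type*) [MeasurableSpace C] where
  /-- the graph of round `r` -/
  graph : ℕ → Choices n C → SimpleGraph (Fin n)
  oblivious : ∀ (r : ℕ) (ω ω' : Choices n C),
    (∀ i, i + τ ≤ r → ω i = ω' i) → graph r ω = graph r ω'
  measurableSet_graph : ∀ (r : ℕ) (G : SimpleGraph (Fin n)), MeasurableSet {ω | graph r ω = G}

/-- The adversary provides a `T`-interval `k`-connected network, whatever the choices are. -/
def ObliviousAdversary.IsIntervalConnected {τ n : ℕ} {C : Type*} [MeasurableSpace C]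
    (A : ObliviousAdversary τ n C) (T k : ℕ) : Prop :=
  ∀ ω : Choices n C, RadioBroadcast.IsIntervalConnected (fun r => A.graph r ω) T k

/-- The situation between two rounds: the states of all nodes, and which nodes are informed, that
is, know the broadcast message. -/
structure Config (n : ℕ) (S : Type*) where
  /-- the states -/
  state : Fin n → S
  /-- the informed nodes -/
  informed : Set (Fin n)

section Radio

variable {n : ℕ}

/-- Node `v` receives the message of node `u` when the graph is `G` and the nodes in `X` transmit:
`v` listens, and `u` is the only neighbor of `v` that transmits. -/
def Receives (G : SimpleGraph (Fin n)) (X : Set (Fin n)) (v u : Fin n) : Prop :=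
  v ∉ X ∧ {w | w ∈ X ∧ G.Adj v w} = {u}

namespace Algorithm

variable {S C M : Type*} [MeasurableSpace S] [MeasurableSpace C] [MeasurableSpace M]

/-- The nodes that transmit in round `r`: only informed nodes can. -/
def transmitters (𝒜 : Algorithm n S C M) (r : ℕ) (c : Fin n → C) (K : Config n S) :
    Set (Fin n) :=
  {u | u ∈ K.informed ∧ (K.state u, c u) ∈ 𝒜.sends u r}

open Classical in
/-- Round `r`, on the graph `G`, with the random choices `c` of that round. -/
noncomputable def step (𝒜 : Algorithm n S C M) (r : ℕ) (G : SimpleGraph (Fin n))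
    (c : Fin n → C) (K : Config n S) : Config n S where
  state := fun v =>
    if h : ∃ u, Receives G (𝒜.transmitters r c K) v u then
      𝒜.onMessage v r ((K.state v, c v), 𝒜.message h.choose r (K.state h.choose, c h.choose))
    else 𝒜.onSilence v r (K.state v, c v)
  informed := K.informed ∪
    {v | ∃ u, Receives G (𝒜.transmitters r c K) v u ∧
      𝒜.message u r (K.state u, c u) ∈ 𝒜.payload}

/-- The situation after the first `r` rounds (rounds `0, …, r - 1`) of the algorithm against the
adversary `A`. At the beginning only the source is informed. -/
noncomputable def run (𝒜 : Algorithm n S C M) (source : Fin n) {τ : ℕ}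
    (A : ObliviousAdversary τ n C) (ω : Choices n C) : ℕ → Config n S
  | 0 => ⟨𝒜.init, {source}⟩
  | r + 1 => 𝒜.step r (A.graph r ω) (ω r) (𝒜.run source A ω r)

/-- The number of rounds until all nodes are informed (`∞` if this never happens). -/
noncomputable def broadcastTime (𝒜 : Algorithm n S C M) (source : Fin n) {τ : ℕ}
    (A : ObliviousAdversary τ n C) (ω : Choices n C) : ℝ≥0∞ :=
  ⨅ (r : ℕ) (_ : (𝒜.run source A ω r).informed = Set.univ), (r : ℝ≥0∞)

/-- The distribution of the random choices: all of them are independent, and node `u` draws from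
`law u` in each round. -/
noncomputable def choiceMeasure (𝒜 : Algorithm n S C M) : Measure (Choices n C) :=
  haveI := 𝒜.isProbabilityMeasure_law
  Measure.infinitePi fun _ : ℕ => Measure.pi 𝒜.law

/-- The expected number of rounds until all nodes are informed. -/
noncomputable def expectedBroadcastTime (𝒜 : Algorithm n S C M) (source : Fin n) {τ : ℕ}
    (A : ObliviousAdversary τ n C) : ℝ≥0∞ :=
  ∫⁻ ω, 𝒜.broadcastTime source A ω ∂𝒜.choiceMeasure

end Algorithm

end Radio

end RadioBroadcast

/-! Cut the vertices into about $m = n/k$ groups of at least $k$ vertices: pools and blocks. The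
pools and the blocks already given up form the left side, a clique; the remaining blocks form the
right side, another clique. The sides are joined only through a constant number of slots, each of
which links its current block to one secret pool. The secrets, the key, are independent for
different slots and phases; a phase lasts `2 * T` rounds.

Whether many transmitters are expected in a round is determined by the past. If so, the adversary
plays the complete graph: with high probability two nodes transmit, and nobody receives anything. If
not, with high probability only $O(\log m)$ nodes transmit. A right vertex can then receive only if
the secret pool of its block contains a transmitter, and in that case the block moves to the left
after the round. Hence informed vertices are always on the left (`Algorithm.onLeft_of_informed`).

For interval connectivity there are two classes of slots with phases shifted by `T`, so that one
class is always in the second half of its phase, and the links of its living slots have been present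
for `T` rounds. Whenever blocks move, one such mature block moves with them and ties them to the
left side in every window (`Design.IsTrace.isIntervalConnected`).

It remains to count hits, although the algorithm may learn from earlier rounds. For fixed random
choices, the keys under which all coordinates of a set $s$ are hit make up a fraction of at most
$(2T\,\mathrm{cap}/\mathrm{pools})^{|s|}$, as if hits were independent: such a key can be decoded
from its values outside $s$ and, for each coordinate in $s$, the time of the hit within its phase
and the index of its pool among the pools hit then (`Algorithm.card_keys_le`). Since $T$ is at most
of order $m^{1-\varepsilon}$, a suitable constant number of hits in one phase is polynomially
unlikely, so constantly many slots survive every phase. The expected total number of hits in $R$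
rounds is $O(R\log m/m)$, and the supply of blocks is of order $m$, so $R$ can be of order $m^2/\log
m$. Averaging over keys gives one fixed key that works with probability at least $1/2$. -/

namespace RadioBroadcast

/-! ### Phases of the two classes -/

/-- The index of the phase of class `c` that contains round `r`: phases last `2 * T` rounds, and
the phases of the two classes are shifted by `T` rounds. -/
def phase (T : ℕ) (c : Bool) (r : ℕ) : ℕ := (r + if c then T else 0) / (2 * T)

/-- The class that is in the second half of its phase in round `r`. -/
def mature (T r : ℕ) : Bool := decide (r / T % 2 = 0)

theorem add_div_two_mul_eq {T r b : ℕ} (h₁ : 2 * T * b ≤ r) (h₂ : r < 2 * T * b + 2 * T) :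
    r / (2 * T) = b := by
  apply Nat.div_eq_of_lt_le <;> nlinarith

/-- In round `e` the mature class is at least `T` rounds into its phase, so the whole window back to
`r` lies in that phase. -/
theorem phase_mature {T r e : ℕ} (hre : r ≤ e) (her : e < r + T) :
    phase T (mature T e) r = phase T (mature T e) e := by
  have hT : 0 < T := by omega
  have hd := Nat.div_add_mod e T
  have hm := Nat.mod_lt e hT
  obtain ⟨b, hb | hb⟩ := Nat.even_or_odd' (e / T)
  · have hc : mature T e = true := by simp [mature, hb]
    rw [hb] at hd
    have hd' : T * (2 * b) = 2 * T * b := by ring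
    rw [hc, phase, phase, add_div_two_mul_eq (b := b), add_div_two_mul_eq (b := b)] <;>
      simp <;> omega
  · have hc : mature T e = false := by simp [mature, hb]
    rw [hb] at hd
    have hd' : T * (2 * b + 1) = 2 * T * b + T := by ring
    rw [hc, phase, phase, add_div_two_mul_eq (b := b), add_div_two_mul_eq (b := b)] <;>
      simp <;> omega

/-- The phase of the other class that overlaps the second half of phase `j` of class `c`. -/
def overlap (c : Bool) (j : ℕ) : ℕ := if c then j else j + 1

theorem phase_not_mature {T : ℕ} (hT : 0 < T) (r : ℕ) :
    phase T (!mature T r) r = overlap (mature T r) (phase T (mature T r) r) := by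
  have hd := Nat.div_add_mod r T
  have hm := Nat.mod_lt r hT
  obtain ⟨b, hb | hb⟩ := Nat.even_or_odd' (r / T)
  · have hc : mature T r = true := by simp [mature, hb]
    rw [hb] at hd
    have hd' : T * (2 * b) = 2 * T * b := by ring
    rw [hc, phase, phase, add_div_two_mul_eq (b := b), add_div_two_mul_eq (b := b)] <;>
      simp [overlap] <;> omega
  · have hc : mature T r = false := by simp [mature, hb]
    rw [hb] at hd
    have hd' : T * (2 * b + 1) = 2 * T * b + T := by ring
    have hd'' : 2 * T * (b + 1) = 2 * T * b + 2 * T := by ring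
    rw [hc, phase, phase, add_div_two_mul_eq (b := b + 1), add_div_two_mul_eq (b := b)] <;>
      simp [overlap] <;> omega

/-! ### The adversary: keys, records and graphs -/

/-- The fixed data of the adversary. The vertices that are labelled by `inl` are on the left side
and form the pools; the other ones form the blocks, indexed by a slot and a depth. -/
structure Design (n : ℕ) where
  /-- half the length of a phase -/
  period : ℕ
  /-- the number of slots of each class -/
  slots : ℕ
  /-- the number of phases for which there are independent keys -/
  phases : ℕ
  /-- the number of pools -/
  pools : ℕ
  /-- the largest depth of a block that is used -/
  depth : ℕ
  /-- the largest number of transmitters that is expected in a light round -/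
  cap : ℕ
  /-- the expected number of transmitters from which on a round is heavy -/
  threshold : ℝ
  /-- the pool or the block of a vertex -/
  label : Fin n → Fin pools ⊕ ((Bool × Fin slots) × ℕ)
  period_pos : 0 < period
  phases_pos : 0 < phases

namespace Design

variable {n : ℕ} (d : Design n)

/-- A slot: a class and an index. -/
abbrev Slot : Type := Bool × Fin d.slots

/-- A slot in a certain phase. -/
abbrev Coord : Type := d.Slot × Fin d.phases

/-- A key assigns to each coordinate the secret pool to which its block is linked. -/
abbrev Key : Type := d.Coord → Fin d.pools

/-- The coordinate of a slot in round `r`. -/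
def coord (r : ℕ) (σ : d.Slot) : d.Coord :=
  -- The remainder only makes the index total; hits are counted before any wrap-around.
  (σ, ⟨phase d.period σ.1 r % d.phases, Nat.mod_lt _ d.phases_pos⟩)

/-- What the adversary remembers. -/
structure Record where
  /-- nothing unexpected has happened -/
  ok : Bool
  /-- the coordinates that are not used any more -/
  dead : Finset d.Coord
  /-- the coordinates whose pool has transmitted -/
  hit : Finset d.Coord

variable {d}

/-- The number of blocks of the slot `σ` that are used up. -/
def count (D : Finset d.Coord) (σ : d.Slot) : ℕ := (D.filter (·.1 = σ)).card

variable (d) in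
/-- Some slot of the class `mature r'` is alive in round `r`. -/
def Alive (r : ℕ) (D : Finset d.Coord) : Prop :=
  ∃ σ : d.Slot, σ.1 = mature d.period r ∧ d.coord r σ ∉ D

open Classical in
/-- The coordinates that are hit in round `r`, if `X` are the transmitters. -/
noncomputable def hits (ξ : d.Key) (r : ℕ) (D : Finset d.Coord) (X : Set (Fin n)) :
    Finset d.Coord :=
  {κ | κ ∉ D ∧ d.coord r κ.1 = κ ∧ ∃ u ∈ X, d.label u = Sum.inl (ξ κ)}

open Classical in
variable (d) in
/-- A mature coordinate outside `D`, if there is one. -/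
noncomputable def partner (r : ℕ) (D : Finset d.Coord) : Finset d.Coord :=
  if h : d.Alive r D then {d.coord r h.choose} else ∅

open Classical in
variable (d) in
/-- The coordinates that are dead after a round in which the coordinates in `H` are hit. -/
noncomputable def kill (r : ℕ) (D H : Finset d.Coord) : Finset d.Coord :=
  -- A living mature coordinate is sacrificed along with the hits: its block has long-standing links
  -- to a pool, and these keep all the moving blocks connected to the left side.
  if H = ∅ then D else D ∪ H ∪ d.partner r (D ∪ H)

variable (d) in
/-- The adversary can go on after round `r`, in which the coordinates in `H` were hit. -/
def Sound (r : ℕ) (D H : Finset d.Coord) : Prop :=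
  (H.Nonempty → d.Alive r (D ∪ H)) ∧ d.Alive (r + 1) (d.kill r D H) ∧
    ∀ σ, count (d.kill r D H) σ ≤ d.depth

variable (d) in
/-- The number of transmitters is far from its expectation. -/
def Deviates (heavy : Prop) (X : Set (Fin n)) : Prop :=
  (heavy ∧ X.ncard ≤ 1) ∨ (¬heavy ∧ d.cap < X.ncard)

open Classical in
/-- The coordinates that are hit in a round that may be heavy. -/
noncomputable def struck (ξ : d.Key) (r : ℕ) (heavy : Prop) (D : Finset d.Coord)
    (X : Set (Fin n)) : Finset d.Coord :=
  if heavy then ∅ else hits ξ r D X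

open Classical in
/-- The record after a round. -/
noncomputable def update (ξ : d.Key) (r : ℕ) (heavy : Prop) (X : Set (Fin n)) (a : d.Record) :
    d.Record :=
  if a.ok = true then
    if d.Deviates heavy X then ⟨false, a.dead, a.hit⟩
    else
      ⟨decide (d.Sound r a.dead (struck ξ r heavy a.dead X)),
        d.kill r a.dead (struck ξ r heavy a.dead X), a.hit ∪ struck ξ r heavy a.dead X⟩
  else a

variable (d) in
/-- The vertices on the left side. -/
def OnLeft (D : Finset d.Coord) (v : Fin n) : Prop :=
  ∀ σ l, d.label v = Sum.inr (σ, l) → l < count D σ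

/-- The pool vertex `v` is linked to the block vertex `w`. -/
def Linked (ξ : d.Key) (r : ℕ) (D : Finset d.Coord) (v w : Fin n) : Prop :=
  ∃ σ, d.coord r σ ∉ D ∧ d.label v = Sum.inl (ξ (d.coord r σ)) ∧
    d.label w = Sum.inr (σ, count D σ)

/-- The graph of a light round. -/
def lightGraph (ξ : d.Key) (r : ℕ) (D : Finset d.Coord) : SimpleGraph (Fin n) where
  Adj v w := v ≠ w ∧ ((d.OnLeft D v ↔ d.OnLeft D w) ∨ Linked ξ r D v w ∨ Linked ξ r D w v)
  symm := ⟨fun _ _ h => ⟨h.1.symm, h.2.imp Iff.symm Or.symm⟩⟩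
  loopless := ⟨fun _ h => h.1 rfl⟩

open Classical in
/-- The graph of a round. -/
noncomputable def graph (ξ : d.Key) (r : ℕ) (heavy : Prop) (a : d.Record) :
    SimpleGraph (Fin n) :=
  if a.ok = true ∧ ¬heavy then lightGraph ξ r a.dead else ⊤

/-! ### Elementary properties of records -/

theorem subset_kill (r : ℕ) (D H : Finset d.Coord) : D ⊆ d.kill r D H := by
  classical
  unfold kill
  split_ifs
  · rfl
  · exact Finset.subset_union_left.trans Finset.subset_union_left

theorem hit_subset_kill (r : ℕ) (D H : Finset d.Coord) : H ⊆ d.kill r D H := by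
  classical
  unfold kill
  split_ifs with h
  · simp [h]
  · exact Finset.subset_union_right.trans Finset.subset_union_left

theorem coord_of_mem_partner {r : ℕ} {D : Finset d.Coord} {κ : d.Coord}
    (h : κ ∈ d.partner r D) :
    κ.1.1 = mature d.period r ∧ d.coord r κ.1 = κ ∧ κ ∉ D := by
  unfold partner at h
  split_ifs at h with h'
  · rw [Finset.mem_singleton] at h
    subst h
    exact ⟨h'.choose_spec.1, rfl, h'.choose_spec.2⟩
  · simp at h

theorem card_partner_le (r : ℕ) (D : Finset d.Coord) : (d.partner r D).card ≤ 1 := by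
  unfold partner
  split_ifs <;> simp

theorem mem_hits {ξ : d.Key} {r : ℕ} {D : Finset d.Coord} {X : Set (Fin n)} {κ : d.Coord} :
    κ ∈ hits ξ r D X ↔ κ ∉ D ∧ d.coord r κ.1 = κ ∧ ∃ u ∈ X, d.label u = Sum.inl (ξ κ) := by
  simp [hits]

theorem count_mono {D D' : Finset d.Coord} (h : D ⊆ D') (σ : d.Slot) : count D σ ≤ count D' σ :=
  Finset.card_le_card (Finset.filter_subset_filter _ h)

theorem OnLeft.mono {D D' : Finset d.Coord} (h : D ⊆ D') {v : Fin n} (hv : d.OnLeft D v) :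
    d.OnLeft D' v :=
  fun σ l hl => (hv σ l hl).trans_le (count_mono h σ)

theorem onLeft_of_label_inl {D : Finset d.Coord} {v : Fin n} {q} (h : d.label v = Sum.inl q) :
    d.OnLeft D v := by
  intro σ l hl
  simp [h] at hl

theorem onLeft_iff_of_label_inr {D : Finset d.Coord} {v : Fin n} {σ l}
    (h : d.label v = Sum.inr (σ, l)) : d.OnLeft D v ↔ l < count D σ := by
  constructor
  · exact fun hv => hv σ l h
  · intro hl σ' l' h'
    rw [h] at h'
    obtain ⟨rfl, rfl⟩ : σ = σ' ∧ l = l' := by simpa using h'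
    exact hl

theorem dead_subset_update (ξ : d.Key) (r : ℕ) (heavy : Prop) (X : Set (Fin n)) (a : d.Record) :
    a.dead ⊆ (update ξ r heavy X a).dead := by
  classical
  unfold update
  split_ifs <;> first | rfl | exact subset_kill _ _ _

theorem coord_of_mem_struck {ξ : d.Key} {r : ℕ} {heavy : Prop} {D : Finset d.Coord}
    {X : Set (Fin n)} {κ : d.Coord} (h : κ ∈ struck ξ r heavy D X) :
    d.coord r κ.1 = κ ∧ κ ∉ D := by
  unfold struck at h
  split_ifs at h
  · simp at h
  · exact ⟨(mem_hits.1 h).2.1, (mem_hits.1 h).1⟩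

theorem ok_of_ok_update {ξ : d.Key} {r : ℕ} {heavy : Prop} {X : Set (Fin n)} {a : d.Record}
    (h : (update ξ r heavy X a).ok = true) :
    a.ok = true ∧ ¬d.Deviates heavy X ∧ d.Sound r a.dead (struck ξ r heavy a.dead X) ∧
      (update ξ r heavy X a).dead = d.kill r a.dead (struck ξ r heavy a.dead X) := by
  classical
  unfold update at h ⊢
  split_ifs at h ⊢ with h₁ h₂
  · exact ⟨h₁, h₂, by simpa using h, rfl⟩
  · exact absurd h h₁

/-- A coordinate dies only in its phase. -/
theorem coord_of_mem_kill {r : ℕ} {D H : Finset d.Coord} (hH : ∀ κ ∈ H, d.coord r κ.1 = κ)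
    {κ : d.Coord} (h : κ ∈ d.kill r D H) (h' : κ ∉ D) : d.coord r κ.1 = κ := by
  classical
  unfold kill at h
  split_ifs at h with h₁
  · exact absurd h h'
  · simp only [Finset.mem_union] at h
    rcases h with (h | h) | h
    · exact absurd h h'
    · exact hH κ h
    · exact (coord_of_mem_partner h).2.1

theorem coord_of_mem_update {ξ : d.Key} {r : ℕ} {heavy : Prop} {X : Set (Fin n)} {a : d.Record}
    {κ : d.Coord} (h : κ ∈ (update ξ r heavy X a).dead) (h' : κ ∉ a.dead) :
    d.coord r κ.1 = κ := by
  classical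
  unfold update at h
  split_ifs at h with h₁ h₂
  · exact absurd h h'
  · exact coord_of_mem_kill (fun κ hκ => (coord_of_mem_struck hκ).1) h h'
  · exact absurd h h'

/-- In a round in which something dies, a mature coordinate dies. -/
theorem exists_mature_of_mem_update {ξ : d.Key} {r : ℕ} {heavy : Prop} {X : Set (Fin n)}
    {a : d.Record} (hok : (update ξ r heavy X a).ok = true) {κ : d.Coord}
    (h : κ ∈ (update ξ r heavy X a).dead) (h' : κ ∉ a.dead) :
    ∃ σ : d.Slot, σ.1 = mature d.period r ∧ d.coord r σ ∉ a.dead ∧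
      d.coord r σ ∈ (update ξ r heavy X a).dead := by
  classical
  obtain ⟨-, -, hs, hd⟩ := ok_of_ok_update hok
  rw [hd] at h ⊢
  set H := struck ξ r heavy a.dead X
  have hH : H.Nonempty := by
    by_contra hH
    rw [Finset.not_nonempty_iff_eq_empty] at hH
    simp [kill, hH] at h
    exact h' h
  have ha := hs.1 hH
  have hp : d.coord r ha.choose ∈ d.partner r (a.dead ∪ H) := by
    rw [partner, dif_pos ha]
    exact Finset.mem_singleton_self _
  refine ⟨ha.choose, ha.choose_spec.1, ?_, ?_⟩
  · exact fun h => ha.choose_spec.2 (Finset.mem_union_left _ h)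
  · rw [kill, if_neg hH.ne_empty]
    exact Finset.mem_union_right _ hp

theorem count_lt_count {D D' : Finset d.Coord} (h : D ⊆ D') {κ : d.Coord} (h₁ : κ ∉ D)
    (h₂ : κ ∈ D') : count D κ.1 < count D' κ.1 := by
  apply Finset.card_lt_card
  refine ⟨Finset.filter_subset_filter _ h, fun hc => h₁ ?_⟩
  have := hc (Finset.mem_filter.2 ⟨h₂, rfl⟩)
  exact (Finset.mem_filter.1 this).1

/-- A slot has only one coordinate per round, so the depth of its current block advances by at most
one. -/
theorem count_le_succ {D D' : Finset d.Coord} {r : ℕ} {σ : d.Slot}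
    (h : ∀ κ ∈ D', κ ∉ D → d.coord r κ.1 = κ) : count D' σ ≤ count D σ + 1 := by
  classical
  have : D'.filter (·.1 = σ) ⊆ insert (d.coord r σ) (D.filter (·.1 = σ)) := by
    intro κ hκ
    rw [Finset.mem_filter] at hκ
    by_cases hD : κ ∈ D
    · exact Finset.mem_insert_of_mem (Finset.mem_filter.2 ⟨hD, hκ.2⟩)
    · rw [← h κ hκ.1 hD, hκ.2]
      exact Finset.mem_insert_self _ _
  exact (Finset.card_le_card this).trans (Finset.card_insert_le _ _)

end Design

/-! ### Interval connectivity -/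

theorem isVertexConnected_top {n k : ℕ} (hk : k < n) :
    IsVertexConnected (⊤ : SimpleGraph (Fin n)) k := by
  refine ⟨by simpa using hk, fun X hX => ?_⟩
  obtain ⟨b, -, hb⟩ := Finset.exists_mem_notMem_of_card_lt_card
    (s := X) (t := Finset.univ) (by simpa using hX.trans hk)
  rw [SimpleGraph.connected_iff_exists_forall_reachable]
  refine ⟨⟨b, hb⟩, fun w => ?_⟩
  by_cases h : (⟨b, hb⟩ : {v : Fin n | v ∉ X}) = w
  · rw [h]
  · exact SimpleGraph.Adj.reachable (by simpa [Subtype.ext_iff] using h)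

namespace Design

variable {n : ℕ} {d : Design n}

/-- The initial record. -/
def Record.initial : d.Record := ⟨true, ∅, ∅⟩

/-- `a` is the sequence of the records, if `heavy` are the heavy rounds and `X` the transmitters. -/
structure IsTrace (ξ : d.Key) (heavy : ℕ → Prop) (X : ℕ → Set (Fin n)) (a : ℕ → d.Record) :
    Prop where
  zero : a 0 = Record.initial
  succ : ∀ t, a (t + 1) = update ξ t (heavy t) (X t) (a t)

namespace IsTrace

variable {ξ : d.Key} {heavy : ℕ → Prop} {X : ℕ → Set (Fin n)} {a : ℕ → d.Record}

theorem monotone_dead (h : IsTrace ξ heavy X a) : Monotone fun t => (a t).dead := by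
  refine monotone_nat_of_le_succ fun t => ?_
  rw [h.succ]
  exact dead_subset_update _ _ _ _ _

theorem ok_of_le (h : IsTrace ξ heavy X a) {t t' : ℕ} (htt' : t' ≤ t) (ht : (a t).ok = true) :
    (a t').ok = true := by
  induction t, htt' using Nat.le_induction with
  | base => exact ht
  | succ t _ ih =>
    rw [h.succ] at ht
    exact ih (ok_of_ok_update ht).1

theorem alive_of_ok (h : IsTrace ξ heavy X a) (hs : 0 < d.slots) {t : ℕ}
    (ht : (a t).ok = true) :
    d.Alive t (a t).dead ∧ ∀ σ, count (a t).dead σ ≤ d.depth := by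
  cases t with
  | zero =>
    rw [h.zero]
    exact ⟨⟨(_, ⟨0, hs⟩), rfl, by simp [Record.initial]⟩, by simp [Record.initial, count]⟩
  | succ t =>
    rw [h.succ] at ht ⊢
    obtain ⟨-, -, hs, hd⟩ := ok_of_ok_update ht
    rw [hd]
    exact hs.2

theorem exists_dies (h : IsTrace ξ heavy X a) {t t' : ℕ} (htt' : t' ≤ t) {κ : d.Coord}
    (ht : κ ∈ (a t).dead) (ht' : κ ∉ (a t').dead) :
    ∃ u, t' ≤ u ∧ u < t ∧ d.coord u κ.1 = κ := by
  induction t, htt' using Nat.le_induction with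
  | base => exact absurd ht ht'
  | succ t htt' ih =>
    by_cases hκ : κ ∈ (a t).dead
    · obtain ⟨u, h₁, h₂, h₃⟩ := ih hκ
      exact ⟨u, h₁, by omega, h₃⟩
    · rw [h.succ] at ht
      exact ⟨t, htt', by omega, coord_of_mem_update ht hκ⟩

theorem coord_eq_of_mature {r t : ℕ} {σ : d.Slot} (hrt : r ≤ t) (htr : t < r + d.period)
    (hσ : σ.1 = mature d.period t) : d.coord r σ = d.coord t σ := by
  simp only [coord, hσ, phase_mature hrt htr]

/-- A slot advances to its next block only when its coordinate of the current phase dies. For a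
mature slot this coordinate is the same throughout the window, and it is still alive in round `t`.
-/
theorem count_eq_of_alive (h : IsTrace ξ heavy X a) {r t : ℕ} {σ : d.Slot} (hrt : r ≤ t)
    (htr : t < r + d.period) (hσ : σ.1 = mature d.period t) (hd : d.coord t σ ∉ (a t).dead) :
    count (a r).dead σ = count (a t).dead σ := by
  unfold count
  congr 1
  ext κ
  simp only [Finset.mem_filter]
  refine ⟨fun ⟨h₁, h₂⟩ => ⟨h.monotone_dead hrt h₁, h₂⟩, fun ⟨h₁, h₂⟩ => ⟨?_, h₂⟩⟩
  by_contra hκ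
  obtain ⟨u, hu₁, hu₂, hu₃⟩ := h.exists_dies hrt h₁ hκ
  rw [h₂, coord_eq_of_mature hu₂.le (by omega) hσ] at hu₃
  exact hd (hu₃ ▸ h₁)

/-- The links of a coordinate that is mature and alive in round `t` are present for `d.period`
rounds, if the block moves to the left side when the coordinate dies. -/
theorem adj_of_alive (h : IsTrace ξ heavy X a) {r t e : ℕ} {σ : d.Slot}
    (hte : t ≤ e) (her : e < r + d.period) (hσ : σ.1 = mature d.period t)
    (hd : d.coord t σ ∉ (a t).dead) (hdies : t < e → d.coord t σ ∈ (a (t + 1)).dead)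
    {v w : Fin n} (hv : d.label v = Sum.inl (ξ (d.coord t σ)))
    (hw : d.label w = Sum.inr (σ, count (a t).dead σ)) {t' : ℕ} (hrt' : r ≤ t') (hte' : t' ≤ e) :
    (lightGraph ξ t' (a t').dead).Adj v w := by
  refine ⟨fun hvw => by simp [hvw, hw] at hv, ?_⟩
  rcases le_or_gt t' t with htt' | htt'
  · refine Or.inr (Or.inl ⟨σ, ?_, ?_, ?_⟩)
    · rw [coord_eq_of_mature htt' (by omega) hσ]
      exact fun hc => hd (h.monotone_dead htt' hc)
    · rw [coord_eq_of_mature htt' (by omega) hσ, hv]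
    · rw [h.count_eq_of_alive htt' (by omega) hσ hd, hw]
  · refine Or.inl (iff_of_true (onLeft_of_label_inl hv) ?_)
    rw [onLeft_iff_of_label_inr hw]
    exact count_lt_count (h.monotone_dead htt'.le) hd
      (h.monotone_dead (Nat.succ_le_of_lt htt') (hdies (by omega)))

theorem exists_count_eq (h : IsTrace ξ heavy X a) {r e : ℕ} {σ : d.Slot} {l : ℕ} (hre : r ≤ e)
    (hr : count (a r).dead σ ≤ l) (he : l < count (a e).dead σ) :
    ∃ t, r ≤ t ∧ t < e ∧ count (a t).dead σ = l ∧ l < count (a (t + 1)).dead σ := by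
  induction e, hre using Nat.le_induction with
  | base => omega
  | succ e hre ih =>
    rcases lt_or_ge l (count (a e).dead σ) with hl | hl
    · obtain ⟨t, h₁, h₂, h₃⟩ := ih hl
      exact ⟨t, h₁, by omega, h₃⟩
    · refine ⟨e, hre, by omega, ?_, he⟩
      have : count (a (e + 1)).dead σ ≤ count (a e).dead σ + 1 := by
        rw [h.succ]
        exact count_le_succ fun κ => coord_of_mem_update
      omega

/-- After the last good round of a window all graphs are complete and remove no edge from the
intersection, so only the rounds up to `e` matter. -/
theorem exists_last_ok {r T : ℕ} (hr : (a r).ok = true) (hT : 0 < T) :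
    ∃ e, r ≤ e ∧ e < r + T ∧ (a e).ok = true ∧
      ∀ t, e < t → t < r + T → (a t).ok = false := by
  induction T, hT using Nat.le_induction with
  | base => exact ⟨r, le_rfl, by omega, hr, fun t _ _ => by omega⟩
  | succ T hT ih =>
    by_cases hok : (a (r + T)).ok = true
    · exact ⟨r + T, by omega, by omega, hok, fun t _ _ => by omega⟩
    · obtain ⟨e, h₁, h₂, h₃, h₄⟩ := ih
      refine ⟨e, h₁, by omega, h₃, fun t h₅ h₆ => ?_⟩
      rcases (show t < r + T ∨ t = r + T by omega) with h₇ | rfl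
      · exact h₄ t h₅ h₇
      · simpa using hok

/-- Fewer than `k` deletions leave a vertex in every pool and in every block that is used, and
distinct vertices that share a side in each round are adjacent in the intersection. The bridge
between the sides is the block of a mature coordinate: linked to a pool while the coordinate lives,
and on the left, in a clique with that pool, afterwards. -/
theorem isIntervalConnected (h : IsTrace ξ heavy X a) {k : ℕ} (hk : k < n)
    (hs : 0 < d.slots) (hpools : 0 < d.pools)
    (hpool : ∀ q, k ≤ (Finset.univ.filter fun v => d.label v = Sum.inl q).card)
    (hblock : ∀ σ, ∀ l ≤ d.depth,
      k ≤ (Finset.univ.filter fun v => d.label v = Sum.inr (σ, l)).card) :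
    IsIntervalConnected (fun t => graph ξ t (heavy t) (a t)) d.period k := by
  intro r
  by_cases hr : (a r).ok = true
  swap
  · have htop : (⨅ i ∈ Set.Ico r (r + d.period), graph ξ i (heavy i) (a i)) = ⊤ := by
      simp only [iInf_eq_top]
      intro i hi
      rw [graph, if_neg]
      exact fun hc => hr (h.ok_of_le hi.1 hc.1)
    rw [htop]
    exact isVertexConnected_top hk
  obtain ⟨e, hre, her, he, hlast⟩ := exists_last_ok hr d.period_pos
  refine ⟨by simpa using hk, fun Y hY => ?_⟩
  set J := ⨅ i ∈ Set.Ico r (r + d.period), graph ξ i (heavy i) (a i) with hJ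
  have hadj : ∀ v w, (∀ t, r ≤ t → t ≤ e → (lightGraph ξ t (a t).dead).Adj v w) → J.Adj v w := by
    intro v w hvw
    have hne : v ≠ w := (hvw r le_rfl hre).1
    simp only [hJ, SimpleGraph.iInf_adj]
    refine ⟨fun i => ⟨fun hi => ?_, hne⟩, hne⟩
    unfold graph
    split_ifs with hc
    · rcases le_or_gt i e with hie | hie
      · exact hvw i hi.1 hie
      · simp [hlast i hie hi.2] at hc
    · exact hne
  have hpick : ∀ x, k ≤ (Finset.univ.filter fun v => d.label v = x).card →
      ∃ v, v ∉ Y ∧ d.label v = x := by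
    intro x hx
    obtain ⟨v, hv, hvY⟩ := Finset.exists_mem_notMem_of_card_lt_card (hY.trans_le hx)
    exact ⟨v, hvY, by simpa using hv⟩
  obtain ⟨b, hbY, hb⟩ := hpick _ (hpool ⟨0, hpools⟩)
  have hstep : ∀ v w, v ∉ Y → ∀ hw : w ∉ Y, (∀ t, r ≤ t → t ≤ e →
      v = w ∨ (lightGraph ξ t (a t).dead).Adj v w) → ∀ hv : v ∉ Y,
      (J.induce {v | v ∉ Y}).Reachable ⟨v, hv⟩ ⟨w, hw⟩ := by
    intro v w _ hw hvw hv
    by_cases hvw' : v = w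
    · subst hvw'
      rfl
    · apply SimpleGraph.Adj.reachable
      exact hadj v w fun t h₁ h₂ => (hvw t h₁ h₂).resolve_left hvw'
  have hleft : ∀ v, ∀ hv : v ∉ Y, d.OnLeft (a r).dead v →
      (J.induce {v | v ∉ Y}).Reachable ⟨v, hv⟩ ⟨b, hbY⟩ := by
    intro v hv hl
    refine hstep v b hv hbY (fun t h₁ h₂ => ?_) hv
    rw [or_iff_not_imp_left]
    intro hne
    exact ⟨hne, Or.inl (iff_of_true (hl.mono (h.monotone_dead h₁)) (onLeft_of_label_inl hb))⟩
  have hanch : ∀ t, r ≤ t → t ≤ e → ∀ σ : d.Slot, σ.1 = mature d.period t →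
      d.coord t σ ∉ (a t).dead → (t < e → d.coord t σ ∈ (a (t + 1)).dead) →
      ∀ w, ∀ hw : w ∉ Y, d.label w = Sum.inr (σ, count (a t).dead σ) →
      (J.induce {v | v ∉ Y}).Reachable ⟨w, hw⟩ ⟨b, hbY⟩ := by
    intro t h₁ h₂ σ h₃ h₄ h₅ w hw hlw
    obtain ⟨v, hvY, hv⟩ := hpick _ (hpool (ξ (d.coord t σ)))
    refine SimpleGraph.Reachable.trans (v := ⟨v, hvY⟩) ?_ (hleft v hvY (onLeft_of_label_inl hv))
    exact hstep w v hw hvY (fun t' h₆ h₇ =>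
      Or.inr (h.adj_of_alive h₂ her h₃ h₄ h₅ hv hlw h₆ h₇).symm) hw
  rw [SimpleGraph.connected_iff_exists_forall_reachable]
  refine ⟨⟨b, hbY⟩, fun ⟨w, hw⟩ => SimpleGraph.Reachable.symm ?_⟩
  by_cases hwr : d.OnLeft (a r).dead w
  · exact hleft w hw hwr
  by_cases hwe : d.OnLeft (a e).dead w
  · obtain ⟨σ, l, hl, hrl⟩ : ∃ σ l, d.label w = Sum.inr (σ, l) ∧ count (a r).dead σ ≤ l := by
      unfold OnLeft at hwr
      push Not at hwr
      exact hwr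
    -- The block of `w` moves after round `t`. A mature coordinate dies in the same round, so its
    -- block changes sides together with `w` and serves as the bridge.
    obtain ⟨t, hrt, hte, hcl, hlc⟩ :=
      h.exists_count_eq hre hrl ((onLeft_iff_of_label_inr hl).1 hwe)
    obtain ⟨κ, hκ, hκ'⟩ : ∃ κ, κ ∈ (a (t + 1)).dead ∧ κ ∉ (a t).dead := by
      by_contra! hc
      have := count_mono hc σ
      omega
    have hok := h.ok_of_le (Nat.succ_le_of_lt hte) he
    obtain ⟨π, hπ, hπ₁, hπ₂⟩ : ∃ π : d.Slot, π.1 = mature d.period t ∧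
        d.coord t π ∉ (a t).dead ∧ d.coord t π ∈ (a (t + 1)).dead := by
      rw [Nat.succ_eq_add_one, h.succ] at hok
      rw [h.succ] at hκ ⊢
      exact exists_mature_of_mem_update hok hκ hκ'
    obtain ⟨w', hw', hl'⟩ := hpick _ (hblock π _
      ((h.alive_of_ok hs (h.ok_of_le hte.le he)).2 π))
    refine SimpleGraph.Reachable.trans (v := ⟨w', hw'⟩) ?_
      (hanch t hrt hte.le π hπ hπ₁ (fun _ => hπ₂) w' hw' hl')
    refine hstep w w' hw hw' (fun t' h₁ h₂ => ?_) hw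
    rw [or_iff_not_imp_left]
    refine fun hne => ⟨hne, Or.inl ?_⟩
    rw [onLeft_iff_of_label_inr hl, onLeft_iff_of_label_inr hl']
    rcases le_or_gt t' t with htt' | htt'
    · have h₃ := count_mono (h.monotone_dead htt') σ
      have h₄ := count_mono (h.monotone_dead htt') π
      simp only at h₃ h₄
      constructor <;> intro <;> omega
    · refine iff_of_true (hlc.trans_le (count_mono (h.monotone_dead htt') σ)) ?_
      exact count_lt_count (h.monotone_dead htt'.le) hπ₁ (h.monotone_dead htt' hπ₂)
  -- Here `w` is on the right up to the last good round, and so is the current block of a mature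
  -- slot that is alive then.
  · obtain ⟨⟨σ, hσ, hσ'⟩, hc⟩ := h.alive_of_ok hs he
    obtain ⟨w', hw', hl'⟩ := hpick _ (hblock σ _ (hc σ))
    refine SimpleGraph.Reachable.trans (v := ⟨w', hw'⟩) ?_
      (hanch e hre le_rfl σ hσ hσ' (fun h => absurd h (lt_irrefl _)) w' hw' hl')
    refine hstep w w' hw hw' (fun t' h₁ h₂ => ?_) hw
    rw [or_iff_not_imp_left]
    refine fun hne => ⟨hne, Or.inl (iff_of_false ?_ ?_)⟩
    · exact fun hc => hwe (hc.mono (h.monotone_dead h₂))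
    · rw [onLeft_iff_of_label_inr hl']
      exact (count_mono (h.monotone_dead h₂) σ).not_gt

end IsTrace

end Design

/-! ### Deaths are paid for by hits -/

namespace Design

variable {n : ℕ} {d : Design n}

/-- The coordinates in `D` of class `c` and phase `j`. -/
def inPhase (D : Finset d.Coord) (c : Bool) (j : ℕ) : Finset d.Coord :=
  D.filter fun κ => κ.1.1 = c ∧ κ.2.val = j

theorem slots_le_card_inPhase {r : ℕ} {D : Finset d.Coord} (h : ¬d.Alive r D) :
    ∃ j, d.slots ≤ (inPhase D (mature d.period r) j).card := by
  refine ⟨phase d.period (mature d.period r) r % d.phases, ?_⟩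
  have hinj : Function.Injective fun i : Fin d.slots => d.coord r (mature d.period r, i) := by
    intro i i' h
    simpa [coord] using congrArg (fun κ : d.Coord => κ.1.2) h
  rw [← Fintype.card_fin d.slots, ← Finset.card_univ, ← Finset.card_map ⟨_, hinj⟩]
  refine Finset.card_le_card fun κ hκ => ?_
  obtain ⟨i, -, rfl⟩ := Finset.mem_map.1 hκ
  refine Finset.mem_filter.2 ⟨?_, rfl, rfl⟩
  by_contra hc
  exact h ⟨_, rfl, hc⟩

theorem hit_subset_update (ξ : d.Key) (r : ℕ) (heavy : Prop) (X : Set (Fin n)) (a : d.Record) :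
    a.hit ⊆ (update ξ r heavy X a).hit := by
  classical
  unfold update
  split_ifs <;> first | rfl | exact Finset.subset_union_left

/-- Either the record goes on with the hits of the round, or nothing is recorded any more. -/
theorem update_eq (ξ : d.Key) (r : ℕ) (heavy : Prop) (X : Set (Fin n)) (a : d.Record) :
    ((update ξ r heavy X a).ok = false ∧ (update ξ r heavy X a).dead = a.dead ∧
      (update ξ r heavy X a).hit = a.hit ∧ (a.ok = false ∨ d.Deviates heavy X)) ∨
    (a.ok = true ∧ ¬d.Deviates heavy X ∧
      ((update ξ r heavy X a).ok = true ↔ d.Sound r a.dead (struck ξ r heavy a.dead X)) ∧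
      (update ξ r heavy X a).dead = d.kill r a.dead (struck ξ r heavy a.dead X) ∧
      (update ξ r heavy X a).hit = a.hit ∪ struck ξ r heavy a.dead X) := by
  classical
  unfold update
  split_ifs with h₁ h₂
  · exact Or.inl ⟨rfl, rfl, rfl, Or.inr h₂⟩
  · exact Or.inr ⟨h₁, h₂, by simp, rfl, rfl⟩
  · rw [Bool.not_eq_true] at h₁
    exact Or.inl ⟨h₁, rfl, rfl, Or.inl h₁⟩

/-- A partner is added only if something is hit, so one of the hits pays for it. -/
theorem card_kill_le (r : ℕ) (D H : Finset d.Coord) :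
    (d.kill r D H).card ≤ D.card + 2 * H.card := by
  classical
  unfold kill
  split_ifs with h
  · simp
  · have h₁ := Finset.card_union_le (D ∪ H) (d.partner r (D ∪ H))
    have h₂ := Finset.card_union_le D H
    have h₃ := card_partner_le r (D ∪ H)
    have h₄ := Finset.card_pos.2 (Finset.nonempty_iff_ne_empty.2 h)
    omega

theorem inPhase_union [DecidableEq d.Coord] (D D' : Finset d.Coord) (c : Bool) (j : ℕ) :
    inPhase (D ∪ D') c j = inPhase D c j ∪ inPhase D' c j :=
  Finset.filter_union _ _ _

/-- A partner is charged to a hit of the same round. That hit lies in the partner's own phase, or in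
the phase of the other class that overlaps the second half of the partner's phase. -/
theorem card_inPhase_kill_le {r : ℕ} {D H : Finset d.Coord}
    (hH : ∀ κ ∈ H, d.coord r κ.1 = κ) (hP : ∀ c, phase d.period c r < d.phases) (c : Bool)
    (j : ℕ) :
    (inPhase (d.kill r D H) c j).card ≤
      (inPhase D c j).card + 2 * (inPhase H c j).card + (inPhase H (!c) (overlap c j)).card := by
  classical
  unfold kill
  split_ifs with h
  · omega
  · rw [inPhase_union, inPhase_union]
    have h₁ := Finset.card_union_le (inPhase D c j ∪ inPhase H c j)
      (inPhase (d.partner r (D ∪ H)) c j)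
    have h₂ := Finset.card_union_le (inPhase D c j) (inPhase H c j)
    rcases Finset.eq_empty_or_nonempty (inPhase (d.partner r (D ∪ H)) c j) with h₃ | ⟨π, hπ⟩
    · rw [h₃, Finset.union_empty]
      omega
    · have h₃ := (Finset.card_le_card (Finset.filter_subset (fun κ : d.Coord =>
        κ.1.1 = c ∧ κ.2.val = j) (d.partner r (D ∪ H)))).trans (card_partner_le r (D ∪ H))
      change (inPhase (d.partner r (D ∪ H)) c j).card ≤ 1 at h₃
      obtain ⟨hπ, hc, hj⟩ := Finset.mem_filter.1 hπ
      obtain ⟨hm, hr, -⟩ := coord_of_mem_partner hπ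
      have hval : ∀ κ : d.Coord, d.coord r κ.1 = κ → κ.2.val = phase d.period κ.1.1 r := by
        intro κ hκ
        rw [← hκ]
        exact Nat.mod_eq_of_lt (hP _)
      rw [hval π hr, hc] at hj
      rw [hc] at hm
      obtain ⟨κ, hκ⟩ := Finset.nonempty_iff_ne_empty.2 h
      have hκ' := hval κ (hH κ hκ)
      rcases Bool.eq_or_eq_not κ.1.1 c with hκc | hκc
      · have : 0 < (inPhase H c j).card :=
          Finset.card_pos.2 ⟨κ, Finset.mem_filter.2 ⟨hκ, hκc, by rw [hκ', hκc, hj]⟩⟩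
        omega
      · have : 0 < (inPhase H (!c) (overlap c j)).card := by
          refine Finset.card_pos.2 ⟨κ, Finset.mem_filter.2 ⟨hκ, hκc, ?_⟩⟩
          rw [hκ', hκc, ← hj, hm, phase_not_mature d.period_pos]
        omega

namespace IsTrace

variable {ξ : d.Key} {heavy : ℕ → Prop} {X : ℕ → Set (Fin n)} {a : ℕ → d.Record}

theorem monotone_hit (h : IsTrace ξ heavy X a) : Monotone fun t => (a t).hit := by
  refine monotone_nat_of_le_succ fun t => ?_
  rw [h.succ]
  exact hit_subset_update _ _ _ _ _

theorem hit_subset_dead (h : IsTrace ξ heavy X a) (t : ℕ) : (a t).hit ⊆ (a t).dead := by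
  classical
  induction t with
  | zero => simp [h.zero, Record.initial]
  | succ t ih =>
    rw [h.succ]
    rcases update_eq ξ t (heavy t) (X t) (a t) with ⟨-, h₁, h₂, -⟩ | ⟨-, -, -, h₁, h₂⟩
    · rwa [h₁, h₂]
    · rw [h₁, h₂]
      exact Finset.union_subset (ih.trans (subset_kill _ _ _)) (hit_subset_kill _ _ _)

theorem disjoint_struck (h : IsTrace ξ heavy X a) (t : ℕ) :
    Disjoint (a t).hit (struck ξ t (heavy t) (a t).dead (X t)) :=
  Finset.disjoint_left.2 fun _ hκ hκ' =>
    (coord_of_mem_struck hκ').2 (h.hit_subset_dead t hκ)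

theorem card_dead_le (h : IsTrace ξ heavy X a) (t : ℕ) :
    (a t).dead.card ≤ 2 * (a t).hit.card := by
  classical
  induction t with
  | zero => simp [h.zero, Record.initial]
  | succ t ih =>
    rw [h.succ]
    rcases update_eq ξ t (heavy t) (X t) (a t) with ⟨-, h₁, h₂, -⟩ | ⟨-, -, -, h₁, h₂⟩
    · rwa [h₁, h₂]
    · rw [h₁, h₂, Finset.card_union_of_disjoint (h.disjoint_struck t)]
      have := card_kill_le t (a t).dead (struck ξ t (heavy t) (a t).dead (X t))
      omega

theorem card_inPhase_dead_le (h : IsTrace ξ heavy X a) {R t : ℕ} (htR : t ≤ R)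
    (hP : ∀ c, ∀ r < R, phase d.period c r < d.phases) (c : Bool) (j : ℕ) :
    (inPhase (a t).dead c j).card ≤
      2 * (inPhase (a t).hit c j).card + (inPhase (a t).hit (!c) (overlap c j)).card := by
  classical
  induction t with
  | zero => simp [h.zero, Record.initial, inPhase]
  | succ t ih =>
    have ih := ih (by omega)
    rw [h.succ]
    rcases update_eq ξ t (heavy t) (X t) (a t) with ⟨-, h₁, h₂, -⟩ | ⟨-, -, -, h₁, h₂⟩
    · rwa [h₁, h₂]
    · have hdis : ∀ c j, Disjoint (inPhase (a t).hit c j)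
          (inPhase (struck ξ t (heavy t) (a t).dead (X t)) c j) := fun c j =>
        (h.disjoint_struck t).mono (Finset.filter_subset _ _) (Finset.filter_subset _ _)
      rw [h₁, h₂, inPhase_union, inPhase_union, Finset.card_union_of_disjoint (hdis _ _),
        Finset.card_union_of_disjoint (hdis _ _)]
      have := card_inPhase_kill_le (r := t) (D := (a t).dead)
        (H := struck ξ t (heavy t) (a t).dead (X t)) (fun κ hκ => (coord_of_mem_struck hκ).1)
        (fun c => hP c t (by omega)) c j
      omega

/-- The adversary gives up only if the number of transmitters deviates from its expectation, or if
many coordinates of one phase are hit, or if many coordinates are hit in total. -/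
theorem many_hits_of_not_ok (h : IsTrace ξ heavy X a) {R q : ℕ} (hq : 3 * q ≤ d.slots)
    (hP : ∀ c, ∀ r < R, phase d.period c r < d.phases) (hok : ¬(a R).ok = true) :
    (∃ t < R, d.Deviates (heavy t) (X t)) ∨ (∃ c j, q ≤ (inPhase (a R).hit c j).card) ∨
      d.depth < 2 * (a R).hit.card := by
  classical
  suffices ∀ t ≤ R, ¬(a t).ok = true → (∃ t < R, d.Deviates (heavy t) (X t)) ∨
      (∃ c j, q ≤ (inPhase (a t).hit c j).card) ∨ d.depth < 2 * (a t).hit.card from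
    this R le_rfl hok
  intro t
  induction t with
  | zero => exact fun _ hc => absurd (by rw [h.zero]; rfl) hc
  | succ t ih =>
    intro htR hok
    have hpart : ∀ r, ¬d.Alive r (a (t + 1)).dead →
        ∃ c j, q ≤ (inPhase (a (t + 1)).hit c j).card := by
      intro r hr
      obtain ⟨j, hj⟩ := slots_le_card_inPhase hr
      -- A completely dead phase has at least `3 * q` dead coordinates, bounded by twice its own
      -- hits plus the hits of the overlapping phase; one of the two phases thus has `q` hits.
      have := h.card_inPhase_dead_le htR hP (mature d.period r) j
      by_cases hq' : q ≤ (inPhase (a (t + 1)).hit (mature d.period r) j).card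
      · exact ⟨_, _, hq'⟩
      · exact ⟨!mature d.period r, overlap (mature d.period r) j, by omega⟩
    have hcard := h.card_dead_le (t + 1)
    rw [h.succ] at hok hpart hcard ⊢
    rcases update_eq ξ t (heavy t) (X t) (a t) with ⟨-, -, h₂, h₃⟩ | ⟨-, -, h₀, h₁, h₂⟩
    · rcases h₃ with h₃ | h₃
      · rw [h₂]
        exact ih (by omega) (by simp [h₃])
      · exact Or.inl ⟨t, htR, h₃⟩
    · rw [h₀] at hok
      rw [h₁] at hpart hcard
      right
      by_contra! hc
      refine hok ⟨fun hne => ?_, ?_, fun σ => ?_⟩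
      · by_contra hA
        obtain ⟨c, j, hj⟩ := hpart t (by
          rw [kill, if_neg hne.ne_empty, partner, dif_neg hA, Finset.union_empty]
          exact hA)
        exact (hc.1 c j).not_ge hj
      · by_contra hA
        obtain ⟨c, j, hj⟩ := hpart (t + 1) hA
        exact (hc.1 c j).not_ge hj
      · exact ((Finset.card_le_card (Finset.filter_subset _ _)).trans hcard).trans hc.2

theorem mem_hits_of_mem_hit (h : IsTrace ξ heavy X a) {t : ℕ} {κ : d.Coord}
    (h₁ : κ ∈ (a (t + 1)).hit) (h₂ : κ ∉ (a t).hit) :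
    (a t).ok = true ∧ ¬heavy t ∧ (X t).ncard ≤ d.cap ∧ κ ∈ hits ξ t (a t).dead (X t) := by
  classical
  rw [h.succ] at h₁
  rcases update_eq ξ t (heavy t) (X t) (a t) with ⟨-, -, h₃, -⟩ | ⟨h₃, h₄, -, -, h₅⟩
  · rw [h₃] at h₁
    exact absurd h₁ h₂
  · rw [h₅, Finset.mem_union, or_iff_right h₂] at h₁
    unfold struck at h₁
    split_ifs at h₁ with hh
    · simp at h₁
    · refine ⟨h₃, hh, ?_, h₁⟩
      by_contra hc
      exact h₄ (Or.inr ⟨hh, not_le.1 hc⟩)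

theorem mem_hit_succ (h : IsTrace ξ heavy X a) {t : ℕ} {κ : d.Coord} (hok : (a t).ok = true)
    (hdev : ¬d.Deviates (heavy t) (X t)) (hh : ¬heavy t)
    (hκ : κ ∈ hits ξ t (a t).dead (X t)) : κ ∈ (a (t + 1)).hit ∧ κ ∉ (a t).hit := by
  classical
  refine ⟨?_, fun hc => (mem_hits.1 hκ).1 (h.hit_subset_dead t hc)⟩
  rw [h.succ, update, if_pos hok, if_neg hdev, struck, if_neg hh]
  exact Finset.mem_union_right _ hκ

theorem exists_time_of_mem_hit (h : IsTrace ξ heavy X a) {R : ℕ} {κ : d.Coord}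
    (hκ : κ ∈ (a R).hit) : ∃ t < R, κ ∈ (a (t + 1)).hit ∧ κ ∉ (a t).hit := by
  induction R with
  | zero => simp [h.zero, Record.initial] at hκ
  | succ R ih =>
    by_cases hκ' : κ ∈ (a R).hit
    · obtain ⟨t, h₁, h₂⟩ := ih hκ'
      exact ⟨t, by omega, h₂⟩
    · exact ⟨R, by omega, hκ, hκ'⟩

theorem time_unique (h : IsTrace ξ heavy X a) {t t' : ℕ} {κ : d.Coord}
    (h₁ : κ ∈ (a (t + 1)).hit) (h₂ : κ ∉ (a t).hit) (h₁' : κ ∈ (a (t' + 1)).hit)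
    (h₂' : κ ∉ (a t').hit) : t = t' := by
  rcases lt_trichotomy t t' with hlt | heq | hlt
  · exact absurd (h.monotone_hit (Nat.succ_le_of_lt hlt) h₁) h₂'
  · exact heq
  · exact absurd (h.monotone_hit (Nat.succ_le_of_lt hlt) h₁') h₂

theorem hit_eq_of_not_ok (h : IsTrace ξ heavy X a) {t R : ℕ} (htR : t ≤ R)
    (hok : (a t).ok = false) : (a R).ok = false ∧ (a R).hit = (a t).hit := by
  induction R, htR using Nat.le_induction with
  | base => exact ⟨hok, rfl⟩
  | succ R _ ih =>
    rw [h.succ, update, if_neg (by simp [ih.1])]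
    exact ih

end IsTrace

end Design

theorem exists_subset_range {α : Type*} {s : Set α} (hs : s.Finite) (hne : s.Nonempty) {m : ℕ}
    (hm : s.ncard ≤ m) : ∃ f : Fin m → α, s ⊆ Set.range f := by
  classical
  obtain ⟨x₀, -⟩ := hne
  lift s to Finset α using hs
  rw [Set.ncard_coe_finset] at hm
  refine ⟨fun i => if h : i.val < s.card then s.equivFin.symm ⟨i, h⟩ else x₀, fun x hx => ?_⟩
  have hlt := (s.equivFin ⟨x, hx⟩).isLt
  exact ⟨⟨_, hlt.trans_le hm⟩, by simp⟩

/-! ### The algorithm against the adversary -/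

namespace Algorithm

variable {n : ℕ} {S C M : Type*} [MeasurableSpace S] [MeasurableSpace C] [MeasurableSpace M]

/-- The step of the algorithm depends only on the neighborhoods in the set of transmitters. -/
theorem step_congr (𝒜 : Algorithm n S C M) {r : ℕ} {G G' : SimpleGraph (Fin n)} {c : Fin n → C}
    {K : Config n S} (h : ∀ v, ∀ w ∈ 𝒜.transmitters r c K, G.Adj v w ↔ G'.Adj v w) :
    𝒜.step r G c K = 𝒜.step r G' c K := by
  have : Receives G (𝒜.transmitters r c K) = Receives G' (𝒜.transmitters r c K) := by
    funext v u
    have : {w | w ∈ 𝒜.transmitters r c K ∧ G.Adj v w} =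
        {w | w ∈ 𝒜.transmitters r c K ∧ G'.Adj v w} := by
      ext w
      exact and_congr_right (h v w)
    simp only [Receives, this]
  unfold step
  rw [this]

open Classical in
/-- The expected number of transmitters is at least `θ`. -/
def Heavy (𝒜 : Algorithm n S C M) (θ : ℝ) (r : ℕ) (K : Config n S) : Prop :=
  θ ≤ ∑ u, if u ∈ K.informed then (𝒜.law u).real {c | (K.state u, c) ∈ 𝒜.sends u r} else 0

/-- The configurations and the records, if the adversary follows the design `d` with the
key `ξ`. -/
noncomputable def simulate (𝒜 : Algorithm n S C M) (source : Fin n) (d : Design n) (ξ : d.Key)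
    (ω : Choices n C) : ℕ → Config n S × d.Record
  | 0 => (⟨𝒜.init, {source}⟩, Design.Record.initial)
  | r + 1 =>
    let p := 𝒜.simulate source d ξ ω r
    (𝒜.step r (Design.graph ξ r (𝒜.Heavy d.threshold r p.1) p.2) (ω r) p.1,
      Design.update ξ r (𝒜.Heavy d.threshold r p.1) (𝒜.transmitters r (ω r) p.1) p.2)

variable (𝒜 : Algorithm n S C M) (source : Fin n) {d : Design n}

theorem isTrace_simulate (ξ : d.Key) (ω : Choices n C) :
    Design.IsTrace ξ (fun t => 𝒜.Heavy d.threshold t (𝒜.simulate source d ξ ω t).1)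
      (fun t => 𝒜.transmitters t (ω t) (𝒜.simulate source d ξ ω t).1)
      (fun t => (𝒜.simulate source d ξ ω t).2) :=
  ⟨rfl, fun _ => rfl⟩

/-- The graph of a round and the test for heaviness use only the situation before that round. This
makes the adversary `1`-oblivious. -/
theorem simulate_congr (ξ : d.Key) {ω ω' : Choices n C} {r : ℕ} (h : ∀ i < r, ω i = ω' i) :
    𝒜.simulate source d ξ ω r = 𝒜.simulate source d ξ ω' r := by
  induction r with
  | zero => rfl
  | succ r ih =>
    simp only [simulate]
    rw [ih fun i hi => h i (by omega), h r (by omega)]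

/-- As long as the adversary goes on, the informed vertices are on the left side. -/
theorem onLeft_of_informed (ξ : d.Key) (ω : Choices n C)
    (hsource : ∃ q, d.label source = Sum.inl q) {t : ℕ}
    (hok : (𝒜.simulate source d ξ ω t).2.ok = true) {v : Fin n}
    (hv : v ∈ (𝒜.simulate source d ξ ω t).1.informed) :
    d.OnLeft (𝒜.simulate source d ξ ω t).2.dead v := by
  classical
  induction t generalizing v with
  | zero =>
    obtain ⟨q, hq⟩ := hsource
    rw [Set.mem_singleton_iff.1 hv]
    exact Design.onLeft_of_label_inl hq
  | succ t ih =>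
    have htr := 𝒜.isTrace_simulate source ξ ω
    have hmono := htr.monotone_dead t.le_succ
    have hok' := hok
    simp only [simulate] at hok' hv hmono ⊢
    generalize 𝒜.simulate source d ξ ω t = p at *
    obtain ⟨h₁, h₂, -, h₄⟩ := Design.ok_of_ok_update hok'
    rw [h₄] at hmono ⊢
    rcases hv with hv | ⟨u, ⟨hvX, hu⟩, -⟩
    · exact (ih h₁ hv).mono hmono
    · set X := 𝒜.transmitters t (ω t) p.1 with hX
      have huX : u ∈ X ∧ (Design.graph ξ t (𝒜.Heavy d.threshold t p.1) p.2).Adj v u := by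
        have : u ∈ ({u} : Set (Fin n)) := rfl
        rwa [← hu] at this
      by_cases hh : 𝒜.Heavy d.threshold t p.1
      -- In the complete graph a reception forces a single transmitter, which in a heavy round
      -- counts as a deviation.
      · exfalso
        refine h₂ (Or.inl ⟨hh, ?_⟩)
        rw [Design.graph, if_neg (fun hc => hc.2 hh)] at hu
        have : X = {u} := by
          rw [← hu]
          ext w
          refine ⟨fun hw => ⟨hw, fun h => hvX ?_⟩, fun hw => hw.1⟩
          rwa [h]
        rw [this, Set.ncard_singleton]
      · rw [Design.graph, if_pos ⟨h₁, hh⟩] at huX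
        have hul : d.OnLeft p.2.dead u := ih h₁ huX.1.1
        -- A transmitter on the left reaches the right side only through a link; the coordinate of
        -- that link is then hit, and its block moves.
        obtain ⟨-, hadj | ⟨σ, -, hlv, -⟩ | ⟨σ, hσ, hlu, hlv⟩⟩ := huX.2
        · exact (hadj.2 hul).mono hmono
        · exact Design.onLeft_of_label_inl hlv
        · rw [Design.onLeft_iff_of_label_inr hlv]
          refine Design.count_lt_count hmono hσ (Design.hit_subset_kill _ _ _ ?_)
          rw [Design.struck, if_neg hh, Design.mem_hits]
          exact ⟨hσ, rfl, u, huX.1, hlu⟩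

/-- As long as the record is good, the current block of a slot has a vertex, and it lies on the
right, where nobody is informed. -/
theorem ne_univ_of_ok (ξ : d.Key) (ω : Choices n C)
    (hsource : ∃ q, d.label source = Sum.inl q) (hs : 0 < d.slots)
    (hblock : ∀ σ, ∀ l ≤ d.depth, ∃ v, d.label v = Sum.inr (σ, l)) {t : ℕ}
    (hok : (𝒜.simulate source d ξ ω t).2.ok = true) :
    (𝒜.simulate source d ξ ω t).1.informed ≠ Set.univ := by
  intro hc
  have hcount := ((𝒜.isTrace_simulate source ξ ω).alive_of_ok hs hok).2 (true, ⟨0, hs⟩)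
  obtain ⟨v, hv⟩ := hblock _ _ hcount
  have := 𝒜.onLeft_of_informed source ξ ω hsource hok (hc ▸ Set.mem_univ v)
  exact lt_irrefl _ ((Design.onLeft_iff_of_label_inr hv).1 this)

/-- Changing the key at coordinates that are not hit does not change the simulation. -/
theorem simulate_succ_congr {ξ ξ' : d.Key} {ω : Choices n C}
    (hsource : ∃ q, d.label source = Sum.inl q) {t : ℕ}
    (heq : 𝒜.simulate source d ξ ω t = 𝒜.simulate source d ξ' ω t)
    (hok : (𝒜.simulate source d ξ ω t).2.ok = true)
    (hh : ¬𝒜.Heavy d.threshold t (𝒜.simulate source d ξ ω t).1)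
    (hhits : Design.hits ξ t (𝒜.simulate source d ξ ω t).2.dead
        (𝒜.transmitters t (ω t) (𝒜.simulate source d ξ ω t).1) =
      Design.hits ξ' t (𝒜.simulate source d ξ ω t).2.dead
        (𝒜.transmitters t (ω t) (𝒜.simulate source d ξ ω t).1))
    (hkey : ∀ κ ∈ Design.hits ξ t (𝒜.simulate source d ξ ω t).2.dead
        (𝒜.transmitters t (ω t) (𝒜.simulate source d ξ ω t).1), ξ κ = ξ' κ) :
    𝒜.simulate source d ξ ω (t + 1) = 𝒜.simulate source d ξ' ω (t + 1) := by
  classical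
  have hleft := fun v => 𝒜.onLeft_of_informed source ξ ω hsource hok (v := v)
  simp only [simulate]
  rw [← heq]
  generalize 𝒜.simulate source d ξ ω t = p at *
  have hlink : ∀ v, ∀ w ∈ 𝒜.transmitters t (ω t) p.1,
      (Design.lightGraph ξ t p.2.dead).Adj v w ↔ (Design.lightGraph ξ' t p.2.dead).Adj v w := by
    intro v w hw
    -- The transmitter `w` is informed, hence on the left, whereas the block end of a link is on the
    -- right.
    have h₁ : ∀ ξ : d.Key, ¬Design.Linked ξ t p.2.dead v w := by
      rintro ξ ⟨σ, -, -, hl⟩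
      exact lt_irrefl _ ((Design.onLeft_iff_of_label_inr hl).1 (hleft w hw.1))
    have h₂ : Design.Linked ξ t p.2.dead w v ↔ Design.Linked ξ' t p.2.dead w v := by
      constructor
      · rintro ⟨σ, hσ, hlw, hlv⟩
        have : d.coord t σ ∈ Design.hits ξ t p.2.dead (𝒜.transmitters t (ω t) p.1) :=
          Design.mem_hits.2 ⟨hσ, rfl, w, hw, hlw⟩
        exact ⟨σ, hσ, hkey _ this ▸ hlw, hlv⟩
      · rintro ⟨σ, hσ, hlw, hlv⟩
        have : d.coord t σ ∈ Design.hits ξ t p.2.dead (𝒜.transmitters t (ω t) p.1) := by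
          rw [hhits]
          exact Design.mem_hits.2 ⟨hσ, rfl, w, hw, hlw⟩
        exact ⟨σ, hσ, (hkey _ this).symm ▸ hlw, hlv⟩
    simp only [Design.lightGraph, h₁, h₂]
  have hstruck : Design.struck ξ t (𝒜.Heavy d.threshold t p.1) p.2.dead
        (𝒜.transmitters t (ω t) p.1) =
      Design.struck ξ' t (𝒜.Heavy d.threshold t p.1) p.2.dead
        (𝒜.transmitters t (ω t) p.1) := by
    rw [Design.struck, Design.struck, if_neg hh, if_neg hh, hhits]
  refine Prod.ext ?_ ?_
  · simp only [Design.graph, if_pos (And.intro hok hh)]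
    exact 𝒜.step_congr hlink
  · simp only [Design.update, hstruck]

/-- The complete graph does not involve the key, and no hit is recorded in such a round. -/
theorem simulate_succ_congr_of_top {ξ ξ' : d.Key} {ω : Choices n C} {t : ℕ}
    (heq : 𝒜.simulate source d ξ ω t = 𝒜.simulate source d ξ' ω t)
    (h : (𝒜.simulate source d ξ ω t).2.ok = false ∨
      𝒜.Heavy d.threshold t (𝒜.simulate source d ξ ω t).1) :
    𝒜.simulate source d ξ ω (t + 1) = 𝒜.simulate source d ξ' ω (t + 1) := by
  classical
  simp only [simulate]
  rw [← heq]
  generalize 𝒜.simulate source d ξ ω t = p at *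
  rcases h with h | h <;> simp [Design.graph, Design.update, Design.struck, h]

end Algorithm

/-! ### Encoding of keys by hits -/

namespace Design

variable {n : ℕ} {d : Design n}

/-- The pools that contain a vertex of `X`. -/
def hitPools (d : Design n) (X : Set (Fin n)) : Set (Fin d.pools) :=
  {q | ∃ u ∈ X, d.label u = Sum.inl q}

theorem ncard_hitPools_le (X : Set (Fin n)) : (d.hitPools X).ncard ≤ X.ncard := by
  have hinj : Function.Injective (Sum.inl : Fin d.pools → Fin d.pools ⊕ (d.Slot × ℕ)) :=
    Sum.inl_injective
  rw [← Set.ncard_image_of_injective _ hinj]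
  refine (Set.ncard_le_ncard ?_ (X.toFinite.image d.label)).trans
    (Set.ncard_image_le X.toFinite)
  rintro _ ⟨q, ⟨u, hu, hq⟩, rfl⟩
  exact ⟨u, hu, hq⟩

variable (d) in
/-- An enumeration of the pools that contain a vertex of `X`, if there are few of them. -/
noncomputable def enumPools (X : Set (Fin n)) : Fin d.cap → Option (Fin d.pools) :=
  open Classical in
  if h : ∃ f : Fin d.cap → Option (Fin d.pools), some '' d.hitPools X ⊆ Set.range f then h.choose
  else fun _ => none

/-- The enumeration depends on the transmitters but not on the key, so an index in it can serve to
decode the key. -/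
theorem exists_enumPools {X : Set (Fin n)} (hX : X.ncard ≤ d.cap) {q : Fin d.pools}
    (hq : q ∈ d.hitPools X) : ∃ i, d.enumPools X i = some q := by
  have h : ∃ f : Fin d.cap → Option (Fin d.pools), some '' d.hitPools X ⊆ Set.range f := by
    refine exists_subset_range (Set.toFinite _) (Set.Nonempty.image _ ⟨q, hq⟩) ?_
    exact (Set.ncard_image_le (Set.toFinite _)).trans ((ncard_hitPools_le X).trans hX)
  have := h.choose_spec ⟨q, hq, rfl⟩
  rw [enumPools, dif_pos h]
  exact this

end Design

namespace Algorithm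

variable {n : ℕ} {S C M : Type*} [MeasurableSpace S] [MeasurableSpace C] [MeasurableSpace M]
variable (𝒜 : Algorithm n S C M) (source : Fin n) {d : Design n}

/-- The coordinate `κ` is hit at offset `p.1` of its phase, through the `p.2`-th pool that
contains a transmitter. -/
def HasCode (ω : Choices n C) (R : ℕ) (ξ : d.Key) (κ : d.Coord) (p : ℕ × Fin d.cap) : Prop :=
  ∃ t < R, κ ∈ (𝒜.simulate source d ξ ω (t + 1)).2.hit ∧ κ ∉ (𝒜.simulate source d ξ ω t).2.hit ∧
    (t + if κ.1.1 then d.period else 0) % (2 * d.period) = p.1 ∧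
    d.enumPools (𝒜.transmitters t (ω t) (𝒜.simulate source d ξ ω t).1) p.2 = some (ξ κ)

theorem exists_hasCode {ω : Choices n C} {R : ℕ} {ξ : d.Key} {κ : d.Coord}
    (h : κ ∈ (𝒜.simulate source d ξ ω R).2.hit) :
    ∃ p : ℕ × Fin d.cap, p.1 < 2 * d.period ∧ 𝒜.HasCode source ω R ξ κ p := by
  have htr := 𝒜.isTrace_simulate source ξ ω
  obtain ⟨t, ht, h₁, h₂⟩ := htr.exists_time_of_mem_hit h
  obtain ⟨-, -, hcap, hhits⟩ := htr.mem_hits_of_mem_hit h₁ h₂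
  obtain ⟨i, hi⟩ := Design.exists_enumPools hcap (Design.mem_hits.1 hhits).2.2
  have := d.period_pos
  exact ⟨(_, i), Nat.mod_lt _ (by omega), t, ht, h₁, h₂, rfl, hi⟩

/-- The phase is part of `κ` and the code supplies the offset, so both keys hit `κ` in the same
round. There the transmitters agree, and the index in their enumeration determines the pool. -/
theorem mem_hits_of_hasCode {ω : Choices n C} {R t : ℕ} {ξ ξ' : d.Key} {κ : d.Coord}
    {p : ℕ × Fin d.cap} (hP : ∀ c, ∀ r < R, phase d.period c r < d.phases) (htR : t < R)
    (heq : 𝒜.simulate source d ξ ω t = 𝒜.simulate source d ξ' ω t)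
    (hcode : 𝒜.HasCode source ω R ξ κ p) (hcode' : 𝒜.HasCode source ω R ξ' κ p)
    (h₁ : κ ∈ (𝒜.simulate source d ξ ω (t + 1)).2.hit)
    (h₂ : κ ∉ (𝒜.simulate source d ξ ω t).2.hit) :
    ξ κ = ξ' κ := by
  have htr := 𝒜.isTrace_simulate source ξ ω
  have htr' := 𝒜.isTrace_simulate source ξ' ω
  obtain ⟨t₁, -, h₃, h₄, h₅, h₆⟩ := hcode
  obtain rfl := htr.time_unique h₁ h₂ h₃ h₄
  obtain ⟨t₂, ht₂, h₃', h₄', h₅', h₆'⟩ := hcode'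
  have hval : ∀ r < R, d.coord r κ.1 = κ → κ.2.val = phase d.period κ.1.1 r := by
    intro r hr hκ
    rw [← hκ]
    exact Nat.mod_eq_of_lt (hP _ _ hr)
  have h₇ := hval _ htR (Design.mem_hits.1 (htr.mem_hits_of_mem_hit h₁ h₂).2.2.2).2.1
  have h₈ := hval _ ht₂ (Design.mem_hits.1 (htr'.mem_hits_of_mem_hit h₃' h₄').2.2.2).2.1
  have h₉ : t = t₂ := by
    have e₁ := Nat.div_add_mod (t + if κ.1.1 then d.period else 0) (2 * d.period)
    have e₂ := Nat.div_add_mod (t₂ + if κ.1.1 then d.period else 0) (2 * d.period)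
    rw [phase] at h₇ h₈
    rw [← h₇, h₅] at e₁
    rw [← h₈, h₅'] at e₂
    omega
  subst h₉
  rw [← heq, h₆] at h₆'
  exact Option.some_injective _ h₆'

/-- A key is determined by its values outside `s` and by the codes of the coordinates in `s`, if
all of them are hit. -/
theorem key_eq_of_hasCode {ω : Choices n C} {R : ℕ} {ξ ξ' : d.Key} {s : Finset d.Coord}
    (hsource : ∃ q, d.label source = Sum.inl q)
    (hP : ∀ c, ∀ r < R, phase d.period c r < d.phases)
    (hs : s ⊆ (𝒜.simulate source d ξ ω R).2.hit) (hout : ∀ κ ∉ s, ξ κ = ξ' κ)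
    (hcode : ∀ κ ∈ s, ∃ p, 𝒜.HasCode source ω R ξ κ p ∧ 𝒜.HasCode source ω R ξ' κ p) :
    ξ = ξ' := by
  have htr := 𝒜.isTrace_simulate source ξ ω
  have htr' := 𝒜.isTrace_simulate source ξ' ω
  by_contra hne
  have hall : ∀ t, (∀ κ ∈ s, κ ∈ (𝒜.simulate source d ξ ω t).2.hit → ξ κ = ξ' κ) →
      ¬s ⊆ (𝒜.simulate source d ξ ω t).2.hit := by
    refine fun t h hc => hne (funext fun κ => ?_)
    by_cases hκ : κ ∈ s
    · exact h κ hκ (hc hκ)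
    · exact hout κ hκ
  suffices ∀ t ≤ R, 𝒜.simulate source d ξ ω t = 𝒜.simulate source d ξ' ω t ∧
      ∀ κ ∈ s, κ ∈ (𝒜.simulate source d ξ ω t).2.hit → ξ κ = ξ' κ from
    hall R (this R le_rfl).2 hs
  intro t
  induction t with
  | zero => exact fun _ => ⟨rfl, fun κ _ hκ => by simp [simulate, Design.Record.initial] at hκ⟩
  | succ t ih =>
    intro htR
    obtain ⟨heq, hagree⟩ := ih (by omega)
    have hagree' : ∀ κ ∈ s, κ ∈ (𝒜.simulate source d ξ ω (t + 1)).2.hit → ξ κ = ξ' κ := by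
      intro κ hκ hκt
      by_cases hκ' : κ ∈ (𝒜.simulate source d ξ ω t).2.hit
      · exact hagree κ hκ hκ'
      · obtain ⟨p, hp, hp'⟩ := hcode κ hκ
        exact 𝒜.mem_hits_of_hasCode source hP (by omega) heq hp hp' hκt hκ'
    refine ⟨?_, hagree'⟩
    by_cases hok : (𝒜.simulate source d ξ ω t).2.ok = true
    swap
    · exact 𝒜.simulate_succ_congr_of_top source heq (Or.inl (by simpa using hok))
    by_cases hh : 𝒜.Heavy d.threshold t (𝒜.simulate source d ξ ω t).1
    · exact 𝒜.simulate_succ_congr_of_top source heq (Or.inr hh)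
    -- A deviation ends the recording for good. All of `s` would have been hit already, and the keys
    -- would be equal.
    have hdev : ¬d.Deviates (𝒜.Heavy d.threshold t (𝒜.simulate source d ξ ω t).1)
        (𝒜.transmitters t (ω t) (𝒜.simulate source d ξ ω t).1) := by
      intro hdev
      have h₁ : (𝒜.simulate source d ξ ω (t + 1)).2.ok = false ∧
          (𝒜.simulate source d ξ ω (t + 1)).2.hit = (𝒜.simulate source d ξ ω t).2.hit := by
        simp [simulate, Design.update, hok, hdev]
      refine hall t hagree ?_
      rw [← h₁.2, ← (htr.hit_eq_of_not_ok (by omega : t + 1 ≤ R) h₁.1).2]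
      exact hs
    have hkey : ∀ κ ∈ Design.hits ξ t (𝒜.simulate source d ξ ω t).2.dead
        (𝒜.transmitters t (ω t) (𝒜.simulate source d ξ ω t).1), ξ κ = ξ' κ := by
      intro κ hκ
      by_cases hκs : κ ∈ s
      · exact hagree' κ hκs (htr.mem_hit_succ hok hdev hh hκ).1
      · exact hout κ hκs
    have hkey' : ∀ κ ∈ Design.hits ξ' t (𝒜.simulate source d ξ ω t).2.dead
        (𝒜.transmitters t (ω t) (𝒜.simulate source d ξ ω t).1), ξ' κ = ξ κ := by
      intro κ hκ
      by_cases hκs : κ ∈ s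
      · rw [heq] at hκ hok hdev hh
        obtain ⟨h₁, h₂⟩ := htr'.mem_hit_succ hok hdev hh hκ
        obtain ⟨p, hp, hp'⟩ := hcode κ hκs
        exact 𝒜.mem_hits_of_hasCode source hP (by omega) heq.symm hp' hp h₁ h₂
      · exact (hout κ hκs).symm
    refine 𝒜.simulate_succ_congr source hsource heq hok hh ?_ hkey
    ext κ
    constructor <;> intro hκ
    · have := hkey κ hκ
      rw [Design.mem_hits] at hκ ⊢
      rwa [← this]
    · have := hkey' κ hκ
      rw [Design.mem_hits] at hκ ⊢
      rwa [← this]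

open Classical in
/-- Few keys lead to a hit of all coordinates in `s`. -/
theorem card_keys_le (ω : Choices n C) {R : ℕ} (hcap : 0 < d.cap)
    (hsource : ∃ q, d.label source = Sum.inl q)
    (hP : ∀ c, ∀ r < R, phase d.period c r < d.phases) (s : Finset d.Coord) :
    (Finset.univ.filter fun ξ : d.Key => s ⊆ (𝒜.simulate source d ξ ω R).2.hit).card *
        d.pools ^ s.card ≤
      (2 * d.period * d.cap) ^ s.card * Fintype.card d.Key := by
  have hex : ∀ ξ : d.Key, ∀ κ : d.Coord, ∃ p : Fin (2 * d.period) × Fin d.cap,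
      κ ∈ (𝒜.simulate source d ξ ω R).2.hit → 𝒜.HasCode source ω R ξ κ (p.1, p.2) := by
    intro ξ κ
    by_cases h : κ ∈ (𝒜.simulate source d ξ ω R).2.hit
    · obtain ⟨p, hp, hp'⟩ := 𝒜.exists_hasCode source h
      exact ⟨(⟨p.1, hp⟩, p.2), fun _ => hp'⟩
    -- An arbitrary code for a coordinate that is not hit.
    · have := d.period_pos
      exact ⟨(⟨0, by omega⟩, ⟨0, hcap⟩), fun hc => absurd hc h⟩
  choose g hg using hex
  have hcard : (Finset.univ.filter fun ξ : d.Key =>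
      s ⊆ (𝒜.simulate source d ξ ω R).2.hit).card ≤
      Fintype.card ((s → Fin (2 * d.period) × Fin d.cap) × ({κ // κ ∉ s} → Fin d.pools)) := by
    refine Finset.card_le_card_of_injOn (t := Finset.univ)
      (fun ξ => (fun κ => g ξ κ, fun κ => ξ κ)) (fun _ _ => Finset.mem_univ _) ?_
    intro ξ hξ ξ' hξ' heq
    simp only [Finset.coe_filter, Finset.mem_univ, true_and, Set.mem_ofPred_eq] at hξ hξ'
    obtain ⟨h₁, h₂⟩ := Prod.ext_iff.1 heq
    refine 𝒜.key_eq_of_hasCode source hsource hP hξ (fun κ hκ => congrFun h₂ ⟨κ, hκ⟩) ?_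
    intro κ hκ
    have h₃ : g ξ κ = g ξ' κ := congrFun h₁ ⟨κ, hκ⟩
    exact ⟨_, hg ξ κ (hξ hκ), h₃ ▸ hg ξ' κ (hξ' hκ)⟩
  refine (Nat.mul_le_mul_right _ hcard).trans_eq ?_
  have h₁ : Fintype.card {κ // κ ∉ s} = Fintype.card d.Coord - s.card := by
    simp [Fintype.card_subtype_compl]
  rw [Fintype.card_prod, Fintype.card_fun, Fintype.card_fun, Fintype.card_fun, Fintype.card_prod,
    Fintype.card_fin, Fintype.card_fin, Fintype.card_fin, Fintype.card_coe, h₁, mul_assoc,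
    ← pow_add, Nat.sub_add_cancel (Finset.card_le_univ s)]

end Algorithm

/-! ### Few keys lead to many hits -/

namespace Design

variable {n : ℕ} {d : Design n}

variable (d) in
/-- So many coordinates are hit that the adversary may have to give up. -/
def Crowded (q : ℕ) (H : Finset d.Coord) : Prop :=
  (∃ c j, q ≤ (inPhase H c j).card) ∨ d.depth < 2 * H.card

/-- The coordinates of class `c` and phase `j` with an index in `I`. -/
def coords (c : Bool) (j : Fin d.phases) (I : Finset (Fin d.slots)) : Finset d.Coord :=
  I.map ⟨fun i => ((c, i), j), fun i i' h => by simpa using h⟩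

theorem exists_coords_subset {q : ℕ} (hq : 0 < q) {H : Finset d.Coord} {c : Bool} {j : ℕ}
    (h : q ≤ (inPhase H c j).card) :
    ∃ j' : Fin d.phases, ∃ I : Finset (Fin d.slots), I.card = q ∧ coords c j' I ⊆ H := by
  classical
  obtain ⟨κ, hκ⟩ := Finset.card_pos.1 (hq.trans_le h)
  obtain ⟨s, hs, hcard⟩ := Finset.exists_subset_card_eq h
  have hs' : ∀ κ' ∈ s, κ' ∈ H ∧ κ' = ((c, κ'.1.2), κ.2) := by
    intro κ' hκ'
    obtain ⟨h₁, h₂, h₃⟩ := Finset.mem_filter.1 (hs hκ')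
    exact ⟨h₁, Prod.ext (Prod.ext h₂ rfl) (Fin.ext (h₃.trans (Finset.mem_filter.1 hκ).2.2.symm))⟩
  refine ⟨κ.2, s.image fun κ' => κ'.1.2, ?_, ?_⟩
  · rw [Finset.card_image_of_injOn, hcard]
    intro κ₁ h₁ κ₂ h₂ heq
    rw [(hs' κ₁ h₁).2, (hs' κ₂ h₂).2, show κ₁.1.2 = κ₂.1.2 from heq]
  · intro κ₁ h₁
    obtain ⟨i, hi, rfl⟩ := Finset.mem_map.1 h₁
    obtain ⟨κ₂, h₂, rfl⟩ := Finset.mem_image.1 hi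
    have := hs' κ₂ h₂
    exact this.2 ▸ this.1

end Design

namespace Algorithm

variable {n : ℕ} {S C M : Type*} [MeasurableSpace S] [MeasurableSpace C] [MeasurableSpace M]
variable (𝒜 : Algorithm n S C M) (source : Fin n) {d : Design n}

open Classical in
-- Union bound over the class, the phase and the at most `2 ^ d.slots` index sets of size `q`.
theorem card_crowded_phase_le (ω : Choices n C) {R q : ℕ} (hq : 0 < q) (hcap : 0 < d.cap)
    (hsource : ∃ q, d.label source = Sum.inl q)
    (hP : ∀ c, ∀ r < R, phase d.period c r < d.phases) :
    (Finset.univ.filter fun ξ : d.Key =>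
        ∃ c j, q ≤ (Design.inPhase (𝒜.simulate source d ξ ω R).2.hit c j).card).card *
        d.pools ^ q ≤
      2 * d.phases * 2 ^ d.slots * ((2 * d.period * d.cap) ^ q * Fintype.card d.Key) := by
  set 𝓘 : Finset (Bool × Fin d.phases × Finset (Fin d.slots)) :=
    Finset.univ.filter fun x => x.2.2.card = q with h𝓘
  have hsub : (Finset.univ.filter fun ξ : d.Key =>
        ∃ c j, q ≤ (Design.inPhase (𝒜.simulate source d ξ ω R).2.hit c j).card) ⊆
      𝓘.biUnion fun x => Finset.univ.filter fun ξ : d.Key =>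
        Design.coords x.1 x.2.1 x.2.2 ⊆ (𝒜.simulate source d ξ ω R).2.hit := by
    intro ξ hξ
    obtain ⟨c, j, hj⟩ := (Finset.mem_filter.1 hξ).2
    obtain ⟨j', I, hI, hsub⟩ := Design.exists_coords_subset hq hj
    exact Finset.mem_biUnion.2 ⟨(c, j', I), Finset.mem_filter.2 ⟨Finset.mem_univ _, hI⟩,
      Finset.mem_filter.2 ⟨Finset.mem_univ _, hsub⟩⟩
  calc _ ≤ (∑ x ∈ 𝓘, (Finset.univ.filter fun ξ : d.Key =>
        Design.coords x.1 x.2.1 x.2.2 ⊆ (𝒜.simulate source d ξ ω R).2.hit).card) *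
          d.pools ^ q :=
        Nat.mul_le_mul_right _ ((Finset.card_le_card hsub).trans Finset.card_biUnion_le)
    _ ≤ ∑ x ∈ 𝓘, (2 * d.period * d.cap) ^ q * Fintype.card d.Key := by
        rw [Finset.sum_mul]
        refine Finset.sum_le_sum fun x hx => ?_
        have := 𝒜.card_keys_le source ω hcap hsource hP (Design.coords x.1 x.2.1 x.2.2)
        rwa [Design.coords, Finset.card_map, (Finset.mem_filter.1 hx).2] at this
    _ ≤ _ := by
        rw [Finset.sum_const, smul_eq_mul]
        refine Nat.mul_le_mul_right _ ((Finset.card_le_univ _).trans_eq ?_)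
        simp [mul_assoc]

open Classical in
-- Double counting: the number of hits is a sum over coordinates, and `card_keys_le` for singletons
-- bounds each term.
theorem sum_card_hit_le (ω : Choices n C) {R : ℕ} (hcap : 0 < d.cap)
    (hsource : ∃ q, d.label source = Sum.inl q)
    (hP : ∀ c, ∀ r < R, phase d.period c r < d.phases) :
    (∑ ξ : d.Key, (𝒜.simulate source d ξ ω R).2.hit.card) * d.pools ≤
      2 * d.slots * d.phases * (2 * d.period * d.cap * Fintype.card d.Key) := by
  have h₁ : ∀ H : Finset d.Coord, H.card = ∑ κ : d.Coord, if κ ∈ H then 1 else 0 := by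
    intro H
    simp
  have h₂ : ∑ ξ : d.Key, (𝒜.simulate source d ξ ω R).2.hit.card =
      ∑ κ : d.Coord, (Finset.univ.filter fun ξ : d.Key =>
        {κ} ⊆ (𝒜.simulate source d ξ ω R).2.hit).card := by
    simp_rw [h₁ (𝒜.simulate source d _ ω R).2.hit]
    rw [Finset.sum_comm]
    refine Finset.sum_congr rfl fun κ _ => ?_
    rw [Finset.card_filter]
    simp
  rw [h₂, Finset.sum_mul]
  calc _ ≤ ∑ κ : d.Coord, 2 * d.period * d.cap * Fintype.card d.Key := by
        refine Finset.sum_le_sum fun κ _ => ?_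
        simpa using 𝒜.card_keys_le source ω hcap hsource hP {κ}
    _ = _ := by
        rw [Finset.sum_const, smul_eq_mul]
        simp [mul_assoc]

open Classical in
/-- For at most a quarter of the keys, there are many hits. -/
theorem card_crowded_le (ω : Choices n C) {R q : ℕ} (hq : 0 < q) (hcap : 0 < d.cap)
    (hpools : 0 < d.pools) (hsource : ∃ q, d.label source = Sum.inl q)
    (hP : ∀ c, ∀ r < R, phase d.period c r < d.phases)
    (h₁ : 16 * d.phases * 2 ^ d.slots * (2 * d.period * d.cap) ^ q ≤ d.pools ^ q)
    (h₂ : 64 * d.slots * d.phases * d.period * d.cap ≤ d.depth * d.pools) :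
    4 * (Finset.univ.filter fun ξ : d.Key =>
        d.Crowded q (𝒜.simulate source d ξ ω R).2.hit).card ≤ Fintype.card d.Key := by
  set F₁ := Finset.univ.filter fun ξ : d.Key =>
    ∃ c j, q ≤ (Design.inPhase (𝒜.simulate source d ξ ω R).2.hit c j).card with hF₁
  set F₂ := Finset.univ.filter fun ξ : d.Key =>
    d.depth < 2 * (𝒜.simulate source d ξ ω R).2.hit.card with hF₂
  have hF : (Finset.univ.filter fun ξ : d.Key =>
      d.Crowded q (𝒜.simulate source d ξ ω R).2.hit) = F₁ ∪ F₂ := by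
    rw [hF₁, hF₂, ← Finset.filter_or]
    exact Finset.filter_congr fun _ _ => Iff.rfl
  have hb₁ : 8 * F₁.card ≤ Fintype.card d.Key := by
    refine Nat.le_of_mul_le_mul_right ?_ (pow_pos hpools q)
    calc 8 * F₁.card * d.pools ^ q = 8 * (F₁.card * d.pools ^ q) := by ring
      _ ≤ 8 * (2 * d.phases * 2 ^ d.slots *
            ((2 * d.period * d.cap) ^ q * Fintype.card d.Key)) :=
          Nat.mul_le_mul_left _ (𝒜.card_crowded_phase_le source ω hq hcap hsource hP)
      _ = 16 * d.phases * 2 ^ d.slots * (2 * d.period * d.cap) ^ q * Fintype.card d.Key := by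
          ring
      _ ≤ d.pools ^ q * Fintype.card d.Key := Nat.mul_le_mul_right _ h₁
      _ = _ := mul_comm _ _
  -- Markov's inequality for the total number of hits. Each of the two kinds of crowding gets an
  -- eighth of the keys.
  have hb₂ : 8 * F₂.card ≤ Fintype.card d.Key := by
    have hm : F₂.card * (d.depth + 1) ≤
        2 * ∑ ξ : d.Key, (𝒜.simulate source d ξ ω R).2.hit.card := by
      rw [Finset.mul_sum, ← smul_eq_mul]
      refine (Finset.card_nsmul_le_sum F₂ _ _ fun ξ hξ => ?_).trans
        (Finset.sum_le_sum_of_subset (Finset.subset_univ F₂))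
      exact (Finset.mem_filter.1 hξ).2
    refine Nat.le_of_mul_le_mul_right ?_ (mul_pos (Nat.add_one_pos d.depth) hpools)
    calc 8 * F₂.card * ((d.depth + 1) * d.pools) =
          8 * (F₂.card * (d.depth + 1)) * d.pools := by ring
      _ ≤ 8 * (2 * ∑ ξ : d.Key, (𝒜.simulate source d ξ ω R).2.hit.card) * d.pools := by gcongr
      _ = 16 * ((∑ ξ : d.Key, (𝒜.simulate source d ξ ω R).2.hit.card) * d.pools) := by ring
      _ ≤ 16 * (2 * d.slots * d.phases * (2 * d.period * d.cap * Fintype.card d.Key)) := by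
          exact Nat.mul_le_mul_left _ (𝒜.sum_card_hit_le source ω hcap hsource hP)
      _ = 64 * d.slots * d.phases * d.period * d.cap * Fintype.card d.Key := by ring
      _ ≤ d.depth * d.pools * Fintype.card d.Key := Nat.mul_le_mul_right _ h₂
      _ ≤ (d.depth + 1) * d.pools * Fintype.card d.Key := by gcongr; omega
      _ = _ := by ring
  rw [hF]
  have := Finset.card_union_le F₁ F₂
  omega

end Algorithm

/-! ### Measurability -/

section Discrete

variable {Ω ι κ β : Type*} [MeasurableSpace Ω] [MeasurableSpace β]

theorem measurable_top_comp {f : Ω → ι} (hf : Measurable[_, ⊤] f) (g : ι → κ) :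
    Measurable[_, ⊤] fun ω => g (f ω) :=
  fun t _ => hf (t := g ⁻¹' t) trivial

theorem measurable_top_const (y : ι) : Measurable[_, ⊤] fun _ : Ω => y := by
  let _ : MeasurableSpace ι := ⊤
  exact measurable_const

theorem measurable_top_of_countable [Countable ι] {f : Ω → ι}
    (hf : ∀ y, MeasurableSet {ω | f ω = y}) : Measurable[_, ⊤] f := by
  let _ : MeasurableSpace ι := ⊤
  exact measurable_to_countable' hf

theorem measurable_top_prodMk [Countable ι] [Countable κ] {f : Ω → ι} {g : Ω → κ}
    (hf : Measurable[_, ⊤] f) (hg : Measurable[_, ⊤] g) :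
    Measurable[_, ⊤] fun ω => (f ω, g ω) := by
  refine measurable_top_of_countable fun ⟨x, y⟩ => ?_
  have : {ω | (f ω, g ω) = (x, y)} = f ⁻¹' {x} ∩ g ⁻¹' {y} := by
    ext ω
    simp
  rw [this]
  exact (hf trivial).inter (hg trivial)

theorem measurable_top_set [Finite ι] {f : Ω → Set ι} (hf : ∀ i, MeasurableSet {ω | i ∈ f ω}) :
    Measurable[_, ⊤] f := by
  refine measurable_top_of_countable fun s => ?_
  have : {ω | f ω = s} = ⋂ i, {ω | i ∈ f ω ↔ i ∈ s} := by
    ext ω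
    simp [Set.ext_iff]
  rw [this]
  refine MeasurableSet.iInter fun i => ?_
  by_cases h : i ∈ s
  · simpa [h] using hf i
  · have h' : {ω | i ∈ f ω ↔ i ∈ s} = {ω | i ∈ f ω}ᶜ := by
      ext ω
      simp [h]
    rw [h']
    exact (hf i).compl

theorem measurable_top_prop {p : Ω → Prop} (hp : MeasurableSet {ω | p ω}) :
    Measurable[_, ⊤] p := by
  refine measurable_top_of_countable fun q => ?_
  by_cases h : q
  · simpa [h] using hp
  · have h' : {ω | p ω = q} = {ω | p ω}ᶜ := by
      ext ω
      simp [h]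
    rw [h']
    exact hp.compl

/-- The states live in an arbitrary space, but the data that select the formula for the next state
are countable, so measurability can be checked for each of their values. -/
theorem measurable_of_pieces [Countable ι] {f : Ω → ι} (hf : Measurable[_, ⊤] f)
    {g : ι → Ω → β} (hg : ∀ i, Measurable (g i)) : Measurable fun ω => g (f ω) ω := by
  let _ : MeasurableSpace ι := ⊤
  have h : Measurable fun p : ι × Ω => g p.1 p.2 := measurable_from_prod_countable_right hg
  exact h.comp (hf.prodMk measurable_id)

end Discrete

instance {n : ℕ} (d : Design n) : Countable d.Record := by
  have : Function.Injective fun a : d.Record => (a.ok, a.dead, a.hit) := by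
    rintro ⟨⟩ ⟨⟩ h
    simpa using h
  exact this.countable

namespace Algorithm

variable {n : ℕ} {S C M : Type*} [MeasurableSpace S] [MeasurableSpace C] [MeasurableSpace M]
variable (𝒜 : Algorithm n S C M) (source : Fin n) {d : Design n}

theorem measurableSet_heavy {Ω : Type*} [MeasurableSpace Ω] (θ : ℝ) (r : ℕ) {K : Ω → Config n S}
    (hs : Measurable fun ω => (K ω).state)
    (hi : Measurable[_, ⊤] fun ω => (K ω).informed) :
    MeasurableSet {ω | 𝒜.Heavy θ r (K ω)} := by
  classical
  refine measurableSet_le measurable_const (Finset.measurable_sum _ fun u _ => ?_)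
  refine Measurable.ite (hi (t := {s | u ∈ s}) trivial) ?_ measurable_const
  have := 𝒜.isProbabilityMeasure_law u
  have h := (measurable_measure_prodMk_left (ν := 𝒜.law u) (𝒜.measurableSet_sends u r)).ennreal_toReal
  exact h.comp ((measurable_pi_apply u).comp hs)

theorem measurableSet_sends_choice {r : ℕ} {K : Choices n C → Config n S}
    (hs : Measurable fun ω => (K ω).state) (u : Fin n) :
    MeasurableSet {ω : Choices n C | ((K ω).state u, ω r u) ∈ 𝒜.sends u r} := by
  have h : Measurable fun ω : Choices n C => ((K ω).state u, ω r u) := by fun_prop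
  exact h (𝒜.measurableSet_sends u r)

theorem measurable_transmitters {r : ℕ} {K : Choices n C → Config n S}
    (hs : Measurable fun ω => (K ω).state) (hi : Measurable[_, ⊤] fun ω => (K ω).informed) :
    Measurable[_, ⊤] fun ω : Choices n C => 𝒜.transmitters r (ω r) (K ω) := by
  refine measurable_top_set fun u => ?_
  exact (hi (t := {s | u ∈ s}) trivial).inter (𝒜.measurableSet_sends_choice hs u)

theorem measurable_simulate (ξ : d.Key) (r : ℕ) :
    (Measurable fun ω => (𝒜.simulate source d ξ ω r).1.state) ∧
      Measurable[_, ⊤] fun ω =>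
        ((𝒜.simulate source d ξ ω r).1.informed, (𝒜.simulate source d ξ ω r).2) := by
  classical
  induction r with
  | zero => exact ⟨measurable_const, measurable_top_const (({source} : Set (Fin n)), Design.Record.initial)⟩
  | succ r ih =>
    obtain ⟨hs, hD⟩ := ih
    have hi : Measurable[_, ⊤] fun ω => (𝒜.simulate source d ξ ω r).1.informed :=
      measurable_top_comp hD Prod.fst
    have hX := 𝒜.measurable_transmitters (r := r) hs hi
    have hH := measurable_top_prop (𝒜.measurableSet_heavy d.threshold r hs hi)
    have hY : Measurable[_, ⊤] fun ω : Choices n C => {u | 𝒜.message u r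
        ((𝒜.simulate source d ξ ω r).1.state u, ω r u) ∈ 𝒜.payload} := by
      refine measurable_top_set fun u => ?_
      have h : Measurable fun ω : Choices n C =>
          𝒜.message u r ((𝒜.simulate source d ξ ω r).1.state u, ω r u) :=
        (𝒜.measurable_message u r).comp (by fun_prop)
      exact h 𝒜.measurableSet_payload
    -- All the discrete data on which a step branches. Once they are fixed, a new state is a
    -- composition of measurable maps.
    have hE := measurable_top_prodMk hD (measurable_top_prodMk hX (measurable_top_prodMk hH hY))
    constructor
    · refine measurable_pi_lambda _ fun v => ?_
      refine measurable_of_pieces hE (g := fun e ω =>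
        if h : ∃ u, Receives (Design.graph ξ r e.2.2.1 e.1.2) e.2.1 v u then
          𝒜.onMessage v r (((𝒜.simulate source d ξ ω r).1.state v, ω r v),
            𝒜.message h.choose r
              ((𝒜.simulate source d ξ ω r).1.state h.choose, ω r h.choose))
        else 𝒜.onSilence v r ((𝒜.simulate source d ξ ω r).1.state v, ω r v)) fun e => ?_
      split_ifs with h
      · refine (𝒜.measurable_onMessage v r).comp (Measurable.prodMk (by fun_prop) ?_)
        exact (𝒜.measurable_message _ r).comp (by fun_prop)
      · exact (𝒜.measurable_onSilence v r).comp (by fun_prop)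
    · exact measurable_top_comp hE fun e =>
        (e.1.1 ∪ {v | ∃ u, Receives (Design.graph ξ r e.2.2.1 e.1.2) e.2.1 v u ∧ u ∈ e.2.2.2},
          Design.update ξ r e.2.2.1 e.2.1 e.1.2)

theorem measurable_simulate_informed (ξ : d.Key) (r : ℕ) :
    Measurable[_, ⊤] fun ω => (𝒜.simulate source d ξ ω r).1.informed :=
  measurable_top_comp (𝒜.measurable_simulate source ξ r).2 Prod.fst

theorem measurable_simulate_record (ξ : d.Key) (r : ℕ) :
    Measurable[_, ⊤] fun ω => (𝒜.simulate source d ξ ω r).2 :=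
  measurable_top_comp (𝒜.measurable_simulate source ξ r).2 Prod.snd

theorem measurable_simulate_heavy (ξ : d.Key) (r : ℕ) :
    Measurable[_, ⊤] fun ω => 𝒜.Heavy d.threshold r (𝒜.simulate source d ξ ω r).1 :=
  measurable_top_prop (𝒜.measurableSet_heavy d.threshold r (𝒜.measurable_simulate source ξ r).1
    (𝒜.measurable_simulate_informed source ξ r))

variable (d) in
/-- The adversary that follows the design `d` with the key `ξ`. -/
noncomputable def adversary (ξ : d.Key) : ObliviousAdversary 1 n C where
  graph r ω := Design.graph ξ r (𝒜.Heavy d.threshold r (𝒜.simulate source d ξ ω r).1)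
    (𝒜.simulate source d ξ ω r).2
  oblivious r ω ω' h := by
    rw [𝒜.simulate_congr source ξ h]
  measurableSet_graph r G := by
    have h := measurable_top_prodMk (𝒜.measurable_simulate_heavy source ξ r)
      (𝒜.measurable_simulate_record source ξ r)
    exact h (t := {e | Design.graph ξ r e.1 e.2 = G}) trivial

theorem run_adversary (ξ : d.Key) (ω : Choices n C) (r : ℕ) :
    𝒜.run source (𝒜.adversary source d ξ) ω r = (𝒜.simulate source d ξ ω r).1 := by
  induction r with
  | zero => rfl
  | succ r ih =>
    rw [run, ih]
    rfl

theorem measurableSet_deviates (ξ : d.Key) (r : ℕ) :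
    MeasurableSet {ω : Choices n C |
      d.Deviates (𝒜.Heavy d.threshold r (𝒜.simulate source d ξ ω r).1)
        (𝒜.transmitters r (ω r) (𝒜.simulate source d ξ ω r).1)} := by
  have h := measurable_top_prodMk (𝒜.measurable_simulate_heavy source ξ r)
    (𝒜.measurable_transmitters (r := r) (𝒜.measurable_simulate source ξ r).1
      (𝒜.measurable_simulate_informed source ξ r))
  exact h (t := {e | d.Deviates e.1 e.2}) trivial

end Algorithm

/-! ### Tail bounds for the number of transmitters -/

section Chernoff

variable {ι C : Type*} [Fintype ι] [MeasurableSpace C] (law : ι → Measure C)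
  [∀ i, IsProbabilityMeasure (law i)] {A : ι → Set C}

open Classical in
-- Markov's inequality for `z` to the number of successes. By independence its expectation is a
-- product of factors `1 + (z - 1) * p`, each at most `exp ((z - 1) * p)`. The values `z = 1 / 2`
-- and `z = 2` give the lower and the upper tail.
theorem mul_measureReal_le_exp (hA : ∀ i, MeasurableSet (A i)) {z b : ℝ} (hz : 0 ≤ z) :
    b * (Measure.pi law).real {c | b ≤ z ^ {i | c i ∈ A i}.ncard} ≤
      Real.exp ((z - 1) * ∑ i, (law i).real (A i)) := by
  have hprod : ∀ c : ι → C, z ^ {i | c i ∈ A i}.ncard =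
      ∏ i, (1 + (A i).indicator (fun _ => z - 1) (c i)) := by
    intro c
    have h₁ : ∀ i, 1 + (A i).indicator (fun _ => z - 1) (c i) = if c i ∈ A i then z else 1 := by
      intro i
      rw [Set.indicator_apply]
      split_ifs <;> ring
    simp_rw [h₁]
    rw [Finset.prod_ite, Finset.prod_const, Finset.prod_const_one, mul_one,
      Set.ncard_eq_toFinset_card']
    congr 2
    ext i
    simp
  have hint : ∀ i, Integrable (fun x => 1 + (A i).indicator (fun _ => z - 1) x) (law i) :=
    fun i => (integrable_const _).add ((integrable_const _).indicator (hA i))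
  have hInt : Integrable (fun c : ι → C => z ^ {i | c i ∈ A i}.ncard) (Measure.pi law) := by
    simp_rw [hprod]
    exact Integrable.fintype_prod hint
  have hmarkov := mul_meas_ge_le_integral_of_nonneg
    (Filter.Eventually.of_forall fun c : ι → C => pow_nonneg hz _) hInt b
  refine hmarkov.trans ?_
  simp_rw [hprod]
  rw [integral_fintype_prod_eq_prod (fun i x => 1 + (A i).indicator (fun _ => z - 1) x),
    Finset.mul_sum, Real.exp_sum]
  have hval : ∀ i, ∫ x, 1 + (A i).indicator (fun _ => z - 1) x ∂law i =
      (z - 1) * (law i).real (A i) + 1 := by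
    intro i
    rw [integral_add (integrable_const _) ((integrable_const _).indicator (hA i)),
      integral_indicator_const _ (hA i)]
    simp
    ring
  refine Finset.prod_le_prod (fun i _ => integral_nonneg fun x => ?_) fun i _ => ?_
  · simp only [Set.indicator_apply, Pi.zero_apply]
    split_ifs <;> linarith
  · rw [hval]
    exact Real.add_one_le_exp _

theorem measureReal_ncard_le_one (hA : ∀ i, MeasurableSet (A i)) {θ : ℝ}
    (hθ : θ ≤ ∑ i, (law i).real (A i)) :
    (Measure.pi law).real {c | {i | c i ∈ A i}.ncard ≤ 1} ≤ 2 * Real.exp (-θ / 2) := by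
  have h := mul_measureReal_le_exp law hA (z := 1 / 2) (b := 1 / 2) (by norm_num)
  have hmono : (Measure.pi law).real {c | {i | c i ∈ A i}.ncard ≤ 1} ≤
      (Measure.pi law).real {c | (1 / 2 : ℝ) ≤ (1 / 2) ^ {i | c i ∈ A i}.ncard} := by
    refine measureReal_mono fun c hc => ?_
    have := pow_le_pow_of_le_one (by norm_num : (0 : ℝ) ≤ 1 / 2) (by norm_num) hc
    rwa [pow_one] at this
  have hexp : Real.exp ((1 / 2 - 1) * ∑ i, (law i).real (A i)) ≤ Real.exp (-θ / 2) :=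
    Real.exp_le_exp.2 (by linarith)
  linarith

theorem measureReal_lt_ncard (hA : ∀ i, MeasurableSet (A i)) {θ : ℝ} (m : ℕ)
    (hθ : ∑ i, (law i).real (A i) ≤ θ) :
    (Measure.pi law).real {c | m < {i | c i ∈ A i}.ncard} ≤ Real.exp θ / 2 ^ m := by
  have h := mul_measureReal_le_exp law hA (z := 2) (b := 2 ^ m) (by norm_num)
  have hmono : (Measure.pi law).real {c | m < {i | c i ∈ A i}.ncard} ≤
      (Measure.pi law).real {c | (2 : ℝ) ^ m ≤ 2 ^ {i | c i ∈ A i}.ncard} :=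
    by
    refine measureReal_mono fun c hc => ?_
    exact pow_le_pow_right₀ (one_le_two (α := ℝ)) (le_of_lt hc)
  have hexp : Real.exp ((2 - 1) * ∑ i, (law i).real (A i)) ≤ Real.exp θ :=
    Real.exp_le_exp.2 (by linarith)
  rw [le_div_iff₀ (by positivity)]
  nlinarith [pow_pos (two_pos : (0 : ℝ) < 2) m]

end Chernoff

/-! ### Success probability and the choice of the key -/

namespace Algorithm

variable {n : ℕ} {S C M : Type*} [MeasurableSpace S] [MeasurableSpace C] [MeasurableSpace M]
variable (𝒜 : Algorithm n S C M) (source : Fin n) {d : Design n}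

instance : IsProbabilityMeasure 𝒜.choiceMeasure := by
  have := 𝒜.isProbabilityMeasure_law
  unfold choiceMeasure
  infer_instance

/-- Given the configuration, the number of transmitters rarely deviates from its expectation. -/
theorem measure_pi_deviates_le {δ : ℝ} (h₁ : 2 * Real.exp (-d.threshold / 2) ≤ δ)
    (h₂ : Real.exp d.threshold / 2 ^ d.cap ≤ δ) (r : ℕ) (K : Config n S) :
    Measure.pi 𝒜.law {c | d.Deviates (𝒜.Heavy d.threshold r K) (𝒜.transmitters r c K)} ≤
      ENNReal.ofReal δ := by
  classical
  have := 𝒜.isProbabilityMeasure_law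
  set A : Fin n → Set C := fun u => {c | u ∈ K.informed ∧ (K.state u, c) ∈ 𝒜.sends u r} with hA
  have hAm : ∀ u, MeasurableSet (A u) := fun u =>
    (MeasurableSet.const _).inter (measurable_prodMk_left (𝒜.measurableSet_sends u r))
  have hX : ∀ c, 𝒜.transmitters r c K = {u | c u ∈ A u} := fun c => rfl
  have hH : 𝒜.Heavy d.threshold r K ↔ d.threshold ≤ ∑ u, (𝒜.law u).real (A u) := by
    unfold Heavy
    refine iff_of_eq (congrArg _ (Finset.sum_congr rfl fun u _ => ?_))
    by_cases hu : u ∈ K.informed <;> simp [hA, hu]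
  simp_rw [hX]
  rw [← ofReal_measureReal]
  refine ENNReal.ofReal_le_ofReal ?_
  by_cases hh : 𝒜.Heavy d.threshold r K
  · simp only [Design.Deviates, hh, true_and, not_true_eq_false, false_and, or_false]
    exact (measureReal_ncard_le_one 𝒜.law hAm (hH.1 hh)).trans h₁
  · simp only [Design.Deviates, hh, false_and, not_false_eq_true, true_and, false_or]
    exact (measureReal_lt_ncard 𝒜.law hAm d.cap (not_le.1 fun hc => hh (hH.2 hc)).le).trans h₂

/-- The situation before round `r` is a function of the earlier choices, which are independent of
those of round `r`. By Fubini the bound for a fixed situation carries over. -/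
theorem measure_deviates_le {δ : ℝ} (h₁ : 2 * Real.exp (-d.threshold / 2) ≤ δ)
    (h₂ : Real.exp d.threshold / 2 ^ d.cap ≤ δ) (ξ : d.Key) (r : ℕ) :
    𝒜.choiceMeasure {ω | d.Deviates (𝒜.Heavy d.threshold r (𝒜.simulate source d ξ ω r).1)
      (𝒜.transmitters r (ω r) (𝒜.simulate source d ξ ω r).1)} ≤ ENNReal.ofReal δ := by
  classical
  have := 𝒜.isProbabilityMeasure_law
  have hC : Nonempty C := nonempty_of_isProbabilityMeasure (𝒜.law source)
  set Z : Set (Choices n C) :=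
    {ω | d.Deviates (𝒜.Heavy d.threshold r (𝒜.simulate source d ξ ω r).1)
      (𝒜.transmitters r (ω r) (𝒜.simulate source d ξ ω r).1)} with hZ
  have hZm : MeasurableSet Z := 𝒜.measurableSet_deviates source ξ r
  -- Rounds after `r` are filled with the choices of round `r`; their values do not matter.
  let join : (Finset.range r → Fin n → C) × (Fin n → C) → Choices n C := fun p i =>
    if h : i ∈ Finset.range r then p.1 ⟨i, h⟩ else p.2
  have hjoin : Measurable join := by
    refine measurable_pi_lambda _ fun i => ?_
    by_cases h : i ∈ Finset.range r
    · simp only [join, dif_pos h]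
      fun_prop
    · simp only [join, dif_neg h]
      fun_prop
  let split : Choices n C → (Finset.range r → Fin n → C) × (Fin n → C) := fun ω =>
    (fun i => ω i, ω r)
  have hsplit : Measurable split := by fun_prop
  have hsim : ∀ x c ω, (∀ i (h : i ∈ Finset.range r), ω i = x ⟨i, h⟩) →
      𝒜.simulate source d ξ (join (x, c)) r = 𝒜.simulate source d ξ ω r := by
    refine fun x c ω h => 𝒜.simulate_congr source ξ fun i hi => ?_
    simp [join, hi, h i (Finset.mem_range.2 hi)]
  have hr : ∀ p, join p r = p.2 := fun p => by simp [join]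
  have hpre : split ⁻¹' (join ⁻¹' Z) = Z := by
    ext ω
    simp only [Set.mem_preimage, hZ, Set.mem_ofPred_eq, hr, split]
    rw [hsim _ _ ω fun i h => rfl]
  have hind := (ProbabilityTheory.iIndepFun_infinitePi (P := fun _ : ℕ => Measure.pi 𝒜.law)
    (X := fun _ x => x) fun _ => measurable_id).indepFun_finset (Finset.range r) {r}
    (by simp) fun i => measurable_pi_apply i
  have hind' := hind.comp measurable_id
    (measurable_pi_apply (⟨r, Finset.mem_singleton_self r⟩ : ({r} : Finset ℕ)))
  have hrestr : Measurable fun (ω : Choices n C) (i : Finset.range r) => ω i :=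
    measurable_pi_lambda _ fun i => measurable_pi_apply _
  have hmap : 𝒜.choiceMeasure.map split =
      (𝒜.choiceMeasure.map fun ω (i : Finset.range r) => ω i).prod (Measure.pi 𝒜.law) := by
    have h := hind'.map_prod_eq_prod_map_map hrestr.aemeasurable
      (measurable_pi_apply r).aemeasurable
    refine h.trans ?_
    congr 1
    exact Measure.infinitePi_map_eval (fun _ : ℕ => Measure.pi 𝒜.law) r
  rw [← hpre, ← Measure.map_apply hsplit (hjoin hZm), hmap, Measure.prod_apply (hjoin hZm)]
  have hprob : IsProbabilityMeasure
      (𝒜.choiceMeasure.map fun ω (i : Finset.range r) => ω i) :=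
    Measure.isProbabilityMeasure_map hrestr.aemeasurable
  calc _ ≤ ∫⁻ _, ENNReal.ofReal δ ∂𝒜.choiceMeasure.map fun ω (i : Finset.range r) => ω i := by
        refine lintegral_mono fun x => ?_
        obtain ⟨c₀⟩ := hC
        let ω₀ : Choices n C := join (x, fun _ => c₀)
        have hsec : Prod.mk x ⁻¹' (join ⁻¹' Z) =
            {c | d.Deviates (𝒜.Heavy d.threshold r (𝒜.simulate source d ξ ω₀ r).1)
              (𝒜.transmitters r c (𝒜.simulate source d ξ ω₀ r).1)} := by
          ext c
          simp only [Set.mem_preimage, hZ, Set.mem_ofPred_eq, hr]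
          rw [hsim x c ω₀ fun i h => by simp [ω₀, join, Finset.mem_range.1 h]]
        rw [hsec]
        exact 𝒜.measure_pi_deviates_le h₁ h₂ r _
    _ = ENNReal.ofReal δ := by simp

theorem le_broadcastTime_of_ok (ξ : d.Key) (ω : Choices n C)
    (hsource : ∃ q, d.label source = Sum.inl q) (hs : 0 < d.slots)
    (hblock : ∀ σ, ∀ l ≤ d.depth, ∃ v, d.label v = Sum.inr (σ, l)) {R : ℕ}
    (hok : (𝒜.simulate source d ξ ω R).2.ok = true) :
    (R : ℝ≥0∞) ≤ 𝒜.broadcastTime source (𝒜.adversary source d ξ) ω := by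
  refine le_iInf₂ fun r hr => ?_
  rw [run_adversary] at hr
  by_contra hc
  have hlt : r < R := by
    rw [not_le] at hc
    exact_mod_cast hc
  exact 𝒜.ne_univ_of_ok source ξ ω hsource hs hblock
    ((𝒜.isTrace_simulate source ξ ω).ok_of_le hlt.le hok) hr

/-- For some key, the probability of many hits is at most `1 / 4`. -/
theorem exists_key_crowded_le {R q : ℕ} (hq : 0 < q) (hcap : 0 < d.cap)
    (hpools : 0 < d.pools) (hsource : ∃ q, d.label source = Sum.inl q)
    (hP : ∀ c, ∀ r < R, phase d.period c r < d.phases)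
    (h₁ : 16 * d.phases * 2 ^ d.slots * (2 * d.period * d.cap) ^ q ≤ d.pools ^ q)
    (h₂ : 64 * d.slots * d.phases * d.period * d.cap ≤ d.depth * d.pools) :
    ∃ ξ : d.Key, 4 * 𝒜.choiceMeasure
      {ω | d.Crowded q (𝒜.simulate source d ξ ω R).2.hit} ≤ 1 := by
  classical
  have hm : ∀ ξ : d.Key, MeasurableSet {ω | d.Crowded q (𝒜.simulate source d ξ ω R).2.hit} :=
    fun ξ => 𝒜.measurable_simulate_record source ξ R (t := {a | d.Crowded q a.hit}) trivial
  have hne : (Finset.univ : Finset d.Key).Nonempty := ⟨fun _ => ⟨0, hpools⟩, Finset.mem_univ _⟩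
  -- Otherwise the probabilities, multiplied by `4`, sum to more than the number of keys. Exchanging
  -- sum and integral contradicts the count `card_crowded_le`, which holds for every `ω`.
  by_contra! hc
  have hlt := ENNReal.sum_lt_sum_of_nonempty hne fun ξ _ => hc ξ
  refine hlt.not_ge ?_
  calc ∑ ξ : d.Key, 4 * 𝒜.choiceMeasure
          {ω | d.Crowded q (𝒜.simulate source d ξ ω R).2.hit}
      = ∑ ξ : d.Key, ∫⁻ ω, {ω | d.Crowded q (𝒜.simulate source d ξ ω R).2.hit}.indicator
          (fun _ => 4) ω ∂𝒜.choiceMeasure := by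
        refine Finset.sum_congr rfl fun ξ _ => ?_
        rw [lintegral_indicator_const (hm ξ)]
    _ = ∫⁻ ω, ∑ ξ : d.Key, {ω | d.Crowded q (𝒜.simulate source d ξ ω R).2.hit}.indicator
          (fun _ => 4) ω ∂𝒜.choiceMeasure := by
        rw [lintegral_finsetSum]
        exact fun ξ _ => measurable_const.indicator (hm ξ)
    _ ≤ ∫⁻ _, (Fintype.card d.Key : ℝ≥0∞) ∂𝒜.choiceMeasure := by
        refine lintegral_mono fun ω => ?_
        have h := 𝒜.card_crowded_le source ω hq hcap hpools hsource hP h₁ h₂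
        simp only [Set.indicator_apply, Set.mem_ofPred_eq]
        rw [Finset.sum_ite, Finset.sum_const, Finset.sum_const_zero, add_zero, nsmul_eq_mul,
          mul_comm]
        exact_mod_cast h
    _ = ∑ ξ : d.Key, 1 := by simp

/-- Deviation and crowding each have probability at most `1 / 4`. So with probability at least `1 /
2` the record is still good after `R` rounds, and then some node is uninformed. -/
theorem exists_key_le_expectedBroadcastTime {R q : ℕ} {δ : ℝ} (hq : 0 < q)
    (hqs : 3 * q ≤ d.slots) (hcap : 0 < d.cap) (hpools : 0 < d.pools)
    (hsource : ∃ q, d.label source = Sum.inl q)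
    (hblock : ∀ σ, ∀ l ≤ d.depth, ∃ v, d.label v = Sum.inr (σ, l))
    (hP : ∀ c, ∀ r < R, phase d.period c r < d.phases)
    (h₁ : 16 * d.phases * 2 ^ d.slots * (2 * d.period * d.cap) ^ q ≤ d.pools ^ q)
    (h₂ : 64 * d.slots * d.phases * d.period * d.cap ≤ d.depth * d.pools)
    (h₃ : 2 * Real.exp (-d.threshold / 2) ≤ δ)
    (h₄ : Real.exp d.threshold / 2 ^ d.cap ≤ δ) (hδ : R * δ ≤ 1 / 4) :
    ∃ ξ : d.Key, ENNReal.ofReal (R / 2) ≤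
      𝒜.expectedBroadcastTime source (𝒜.adversary source d ξ) := by
  classical
  obtain ⟨ξ, hξ⟩ := 𝒜.exists_key_crowded_le source hq hcap hpools hsource hP h₁ h₂
  refine ⟨ξ, ?_⟩
  set μ := 𝒜.choiceMeasure with hμ
  set F : Set (Choices n C) := {ω | d.Crowded q (𝒜.simulate source d ξ ω R).2.hit} with hF
  set Z : ℕ → Set (Choices n C) := fun t => {ω | d.Deviates
    (𝒜.Heavy d.threshold t (𝒜.simulate source d ξ ω t).1)
      (𝒜.transmitters t (ω t) (𝒜.simulate source d ξ ω t).1)} with hZ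
  set G : Set (Choices n C) := {ω | (𝒜.simulate source d ξ ω R).2.ok = true} with hG
  have hGm : MeasurableSet G :=
    𝒜.measurable_simulate_record source ξ R (t := {a | a.ok = true}) trivial
  have hsub : Gᶜ ⊆ (⋃ t ∈ Finset.range R, Z t) ∪ F := by
    intro ω hω
    rcases (𝒜.isTrace_simulate source ξ ω).many_hits_of_not_ok hqs hP hω with ⟨t, ht, h⟩ | h
    · exact Or.inl (Set.mem_biUnion (Finset.mem_coe.2 (Finset.mem_range.2 ht)) h)
    · exact Or.inr h
  have hFr : μ.real F ≤ 1 / 4 := by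
    have : (4 * μ F).toReal ≤ 1 := ENNReal.toReal_le_of_le_ofReal zero_le_one (by simpa using hξ)
    rw [ENNReal.toReal_mul] at this
    simp only [ENNReal.toReal_ofNat] at this
    change 4 * μ.real F ≤ 1 at this
    linarith
  have hδ₀ : 0 ≤ δ := (by positivity : (0 : ℝ) ≤ 2 * Real.exp (-d.threshold / 2)).trans h₃
  have hZr : μ.real (⋃ t ∈ Finset.range R, Z t) ≤ 1 / 4 := by
    refine (measureReal_biUnion_finset_le _ _).trans (le_trans ?_ hδ)
    refine (Finset.sum_le_card_nsmul _ _ δ fun t _ => ?_).trans_eq (by simp)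
    exact ENNReal.toReal_le_of_le_ofReal hδ₀ (𝒜.measure_deviates_le source h₃ h₄ ξ t)
  have hGr : 1 / 2 ≤ μ.real G := by
    have h₅ := (measureReal_mono (μ := μ) hsub).trans (measureReal_union_le _ _)
    rw [probReal_compl_eq_one_sub hGm] at h₅
    linarith
  calc ENNReal.ofReal (R / 2) ≤ ENNReal.ofReal (R * μ.real G) :=
        ENNReal.ofReal_le_ofReal (by nlinarith [(Nat.cast_nonneg R : (0 : ℝ) ≤ R)])
    _ = R * μ G := by
        rw [ENNReal.ofReal_mul (Nat.cast_nonneg R), ENNReal.ofReal_natCast, ofReal_measureReal]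
    _ = ∫⁻ _ in G, R ∂μ := by rw [setLIntegral_const]
    _ ≤ ∫⁻ ω in G, 𝒜.broadcastTime source (𝒜.adversary source d ξ) ω ∂μ :=
        setLIntegral_mono' hGm fun ω hω => 𝒜.le_broadcastTime_of_ok source ξ ω hsource
          (by omega) hblock hω
    _ ≤ _ := setLIntegral_le_lintegral _ _

end Algorithm

/-! ### Layout of the vertices -/

theorem le_card_filter_of_block {n k b : ℕ} (p : Fin n ≃ Fin n) (hb : (b + 1) * k ≤ n)
    {P : Fin n → Prop} [DecidablePred P] (hP : ∀ v, (p v).val / k = b → P v) :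
    k ≤ (Finset.univ.filter P).card := by
  have hlt : ∀ i : Fin k, b * k + i < n := fun i => by
    have := i.isLt
    rw [add_mul] at hb
    omega
  rw [← Fintype.card_fin k, ← Finset.card_univ]
  refine Finset.card_le_card_of_injOn (fun i => p.symm ⟨b * k + i, hlt i⟩) (fun i _ => ?_) ?_
  · simp only [Finset.coe_filter, Finset.mem_univ, true_and, Set.mem_ofPred_eq]
    apply hP
    have hk : 0 < k := i.pos
    simp only [Equiv.apply_symm_apply]
    rw [mul_comm, Nat.mul_add_div hk, Nat.div_eq_of_lt i.isLt, add_zero]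
  · intro i _ j _ hij
    have := congrArg Fin.val (p.symm.injective hij)
    exact Fin.ext (by simpa using this)

/-- A partition of the vertices into pools and blocks. -/
theorem exists_label {n k s Q N : ℕ} (hs : 0 < s) (hQ : 0 < Q)
    (hn : (Q + 2 * s * (N + 1)) * k ≤ n) (source : Fin n) :
    ∃ label : Fin n → Fin Q ⊕ ((Bool × Fin s) × ℕ), (∃ q, label source = Sum.inl q) ∧
      (∀ q, k ≤ (Finset.univ.filter fun v => label v = Sum.inl q).card) ∧
      ∀ σ, ∀ l ≤ N, k ≤ (Finset.univ.filter fun v => label v = Sum.inr (σ, l)).card := by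
  have hn₀ : 0 < n := source.pos
  -- The swap puts the source into the first pool.
  let p : Fin n ≃ Fin n := Equiv.swap source ⟨0, hn₀⟩
  let e : Bool × Fin s ≃ Fin (2 * s) := Fintype.equivFinOfCardEq (by simp)
  -- Groups are runs of `k` consecutive positions; after the pools, each run of `2 * s` groups forms
  -- the blocks of one depth.
  let label : Fin n → Fin Q ⊕ ((Bool × Fin s) × ℕ) := fun v =>
    if h : (p v).val / k < Q then Sum.inl ⟨_, h⟩
    else Sum.inr (e.symm ⟨((p v).val / k - Q) % (2 * s), Nat.mod_lt _ (by omega)⟩,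
      ((p v).val / k - Q) / (2 * s))
  have hinl : ∀ v q, (p v).val / k = q.val → label v = Sum.inl q := by
    intro v q h
    have hlt : (p v).val / k < Q := h ▸ q.isLt
    simp only [label, dif_pos hlt]
    exact congrArg Sum.inl (Fin.ext h)
  refine ⟨label, ⟨⟨0, hQ⟩, hinl _ _ (by simp [p])⟩, fun q => ?_, fun σ l hl => ?_⟩
  · refine le_card_filter_of_block p (le_trans ?_ hn) fun v hv => hinl v q hv
    exact Nat.mul_le_mul_right _ (by omega)
  · have hlt := (e σ).isLt
    refine le_card_filter_of_block (b := Q + (2 * s * l + e σ)) p (le_trans ?_ hn) fun v hv => ?_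
    · refine Nat.mul_le_mul_right _ ?_
      have : 2 * s * (l + 1) ≤ 2 * s * (N + 1) := Nat.mul_le_mul_left _ (by omega)
      rw [mul_add] at this
      omega
    · have hnot : ¬(p v).val / k < Q := by omega
      have hsub : (p v).val / k - Q = 2 * s * l + e σ := by omega
      simp only [label, dif_neg hnot, hsub]
      have h₁ : (2 * s * l + (e σ).val) % (2 * s) = e σ := by
        rw [Nat.mul_add_mod, Nat.mod_eq_of_lt hlt]
      have h₂ : (2 * s * l + (e σ).val) / (2 * s) = l := by
        rw [Nat.mul_add_div (by omega), Nat.div_eq_of_lt hlt, add_zero]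
      simp only [h₁, h₂, Fin.eta, Equiv.symm_apply_apply]

/-- The numerical requirements on a design with period `T`, for which about `m` groups of vertices
are available, and with which the broadcast takes at least `R / 2` rounds in expectation. -/
structure IsFeasible (m T s q Q N cap P R : ℕ) (θ δ : ℝ) : Prop where
  groups : Q + 2 * s * (N + 1) ≤ m
  q_pos : 0 < q
  three_mul_le : 3 * q ≤ s
  cap_pos : 0 < cap
  pools_pos : 0 < Q
  phases : (R + T) / (2 * T) < P
  phase_hits : 16 * P * 2 ^ s * (2 * T * cap) ^ q ≤ Q ^ q
  total_hits : 64 * s * P * T * cap ≤ N * Q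
  lower_tail : 2 * Real.exp (-θ / 2) ≤ δ
  upper_tail : Real.exp θ / 2 ^ cap ≤ δ
  failure : R * δ ≤ 1 / 4

theorem exists_adversary {n k T m s q Q N cap P R : ℕ} {θ δ : ℝ} (hk : 0 < k) (hkn : k < n)
    (hT : 0 < T) (hm : m * k ≤ n) (h : IsFeasible m T s q Q N cap P R θ δ)
    {S C M : Type*} [MeasurableSpace S] [MeasurableSpace C] [MeasurableSpace M]
    (𝒜 : Algorithm n S C M) (source : Fin n) :
    ∃ A : ObliviousAdversary 1 n C, A.IsIntervalConnected T k ∧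
      ENNReal.ofReal (R / 2) ≤ 𝒜.expectedBroadcastTime source A := by
  have hs : 0 < s := by
    have := h.q_pos
    have := h.three_mul_le
    omega
  obtain ⟨label, hsource, hpool, hblock⟩ := exists_label hs h.pools_pos
    ((Nat.mul_le_mul_right k h.groups).trans hm) source
  let d : Design n := ⟨T, s, P, Q, N, cap, θ, label, hT, (Nat.zero_le _).trans_lt h.phases⟩
  have hP : ∀ c, ∀ r < R, phase d.period c r < d.phases := by
    intro c r hr
    refine lt_of_le_of_lt (Nat.div_le_div_right ?_) h.phases
    change (r + if c = true then T else 0) ≤ R + T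
    split_ifs <;> omega
  have hex : ∀ σ, ∀ l ≤ d.depth, ∃ v, d.label v = Sum.inr (σ, l) := by
    intro σ l hl
    obtain ⟨v, hv⟩ := Finset.card_pos.1 (hk.trans_le (hblock σ l hl))
    exact ⟨v, (Finset.mem_filter.1 hv).2⟩
  obtain ⟨ξ, hξ⟩ := 𝒜.exists_key_le_expectedBroadcastTime (d := d) source h.q_pos
    h.three_mul_le h.cap_pos h.pools_pos hsource hex hP h.phase_hits h.total_hits h.lower_tail
    h.upper_tail h.failure
  refine ⟨𝒜.adversary source d ξ, fun ω => ?_, hξ⟩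
  exact (𝒜.isTrace_simulate source ξ ω).isIntervalConnected hkn hs h.pools_pos hpool hblock

/-- The adversary that always provides the complete graph. -/
def completeAdversary (n : ℕ) (C : Type*) [MeasurableSpace C] : ObliviousAdversary 1 n C where
  graph _ _ := ⊤
  oblivious _ _ _ _ := rfl
  measurableSet_graph _ _ := MeasurableSet.const _

theorem isIntervalConnected_completeAdversary {n k : ℕ} (C : Type*) [MeasurableSpace C]
    (hk : k < n) (T : ℕ) : (completeAdversary n C).IsIntervalConnected T k := by
  intro ω r
  have : (⨅ i ∈ Set.Ico r (r + T), (completeAdversary n C).graph i ω) = ⊤ := by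
    simp [completeAdversary]
  rw [this]
  exact isVertexConnected_top hk

theorem one_le_expectedBroadcastTime {n : ℕ} (hn : 2 ≤ n) {S C M : Type*} [MeasurableSpace S]
    [MeasurableSpace C] [MeasurableSpace M] (𝒜 : Algorithm n S C M) (source : Fin n)
    (A : ObliviousAdversary 1 n C) : 1 ≤ 𝒜.expectedBroadcastTime source A := by
  have h : ∀ ω, 1 ≤ 𝒜.broadcastTime source A ω := by
    refine fun ω => le_iInf₂ fun r hr => ?_
    rcases Nat.eq_zero_or_pos r with rfl | hr₀
    · exfalso
      have : Nontrivial (Fin n) := Fin.nontrivial_iff_two_le.2 hn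
      obtain ⟨v, hv⟩ := exists_ne source
      have hmem : v ∈ ({source} : Set (Fin n)) := by
        change ({source} : Set (Fin n)) = Set.univ at hr
        rw [hr]
        exact Set.mem_univ v
      exact hv hmem
    · exact_mod_cast hr₀
  calc (1 : ℝ≥0∞) = ∫⁻ _, 1 ∂𝒜.choiceMeasure := by simp
    _ ≤ _ := lintegral_mono h

/-! ### Choice of the parameters -/

open Filter in
theorem eventually_large (ε : ℝ) (hε : 0 < ε) (K : ℝ) : ∀ᶠ m : ℕ in atTop,
    K ≤ m ∧ 1 ≤ Real.log m ∧ 800 * Real.log m ≤ (m : ℝ) ^ (ε / 2) ∧ K * Real.log m ≤ m := by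
  have hx : Tendsto (fun m : ℕ => (m : ℝ)) atTop atTop := tendsto_natCast_atTop_atTop
  have h₁ := hx.eventually (eventually_ge_atTop K)
  have h₂ := (Real.tendsto_log_atTop.comp hx).eventually (eventually_ge_atTop 1)
  have h₃ := hx.eventually ((isLittleO_log_rpow_atTop (half_pos hε)).bound
    (by norm_num : (0 : ℝ) < 1 / 800))
  have h₄ := hx.eventually (Real.isLittleO_log_id_atTop.bound
    (by positivity : (0 : ℝ) < 1 / (|K| + 1)))
  filter_upwards [h₁, h₂, h₃, h₄] with m h₁ h₂ h₃ h₄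
  have h₂ : 1 ≤ Real.log m := h₂
  have hm : (0 : ℝ) ≤ m := Nat.cast_nonneg m
  refine ⟨h₁, h₂, ?_, ?_⟩
  · rw [Real.norm_of_nonneg (by linarith), Real.norm_of_nonneg (by positivity)] at h₃
    linarith
  · rw [Real.norm_of_nonneg (by linarith), id, Real.norm_of_nonneg hm, one_div,
      inv_mul_eq_div, le_div_iff₀ (by positivity)] at h₄
    nlinarith [le_abs_self K]

/-- As `q * (ε / 2) ≥ 3`, the gain `x ^ (-(ε / 2))` taken `q` times outweighs the factor `Y ≤ x ^
3`, which will come from a union bound. -/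
theorem mul_pow_le_pow_of_rpow {x ε A B Y : ℝ} {q : ℕ} (hx : 1 ≤ x) (hA : 0 ≤ A)
    (hB : 0 ≤ B) (hq : 6 ≤ q * ε) (hAB : A ≤ B * x ^ (-(ε / 2))) (hY : Y ≤ x ^ 3) :
    Y * A ^ q ≤ B ^ q := by
  have hx₀ : 0 < x := by linarith
  have h₁ : A ^ q ≤ B ^ q * x ^ (-(3 : ℝ)) := by
    calc A ^ q ≤ (B * x ^ (-(ε / 2))) ^ q := pow_le_pow_left₀ hA hAB q
      _ = B ^ q * x ^ (-(ε / 2) * q) := by rw [mul_pow, Real.rpow_mul_natCast hx₀.le]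
      _ ≤ _ := by
        gcongr
        linarith
  calc Y * A ^ q ≤ x ^ 3 * (B ^ q * x ^ (-(3 : ℝ))) :=
        mul_le_mul hY h₁ (by positivity) (by positivity)
    _ = B ^ q := by
        rw [Real.rpow_neg hx₀.le, show (3 : ℝ) = (3 : ℕ) by norm_num, Real.rpow_natCast]
        field_simp

/-- The numbers of pools, blocks and rounds for `m` groups of vertices. -/
theorem rounds_bounds {m s cap : ℕ} {L : ℝ} (hs : 0 < s) (hcap : 0 < cap) (hL : 1 ≤ L)
    (hcapL : (cap : ℝ) ≤ 25 * L) (hms : 64 * (s : ℝ) ≤ m)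
    (hmL : 4 * (409600 * (s : ℝ) ^ 2) * L ≤ m) :
    ∃ Q N R : ℕ, (m : ℝ) / 8 ≤ Q ∧ Q + 2 * s * (N + 1) ≤ m ∧ R * (128 * s * cap) ≤ N * Q ∧
      (R : ℝ) ≤ (m : ℝ) ^ 2 / 4 ∧ 2 * (m : ℝ) ≤ R ∧
      (m : ℝ) ^ 2 / (2 * (409600 * (s : ℝ) ^ 2) * L) ≤ R := by
  have hs₀ : (1 : ℝ) ≤ s := by exact_mod_cast hs
  have hs₁ : 0 < 8 * s := by omega
  have hcapr : (0 : ℝ) < cap := by exact_mod_cast hcap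
  generalize hx : (m : ℝ) = x at *
  have hQ₁ : x / 8 ≤ (m / 4 : ℕ) := by
    have := Nat.lt_div_mul_add (a := m) (b := 4) (by norm_num)
    have : (m : ℝ) < (m / 4 : ℕ) * 4 + 4 := by exact_mod_cast this
    linarith
  have hQ₂ : ((m / 4 : ℕ) : ℝ) ≤ x / 4 := by
    have := Nat.cast_div_le (α := ℝ) (m := m) (n := 4)
    rwa [hx] at this
  have hN' : 1 ≤ m / (8 * s) := by
    rw [Nat.one_le_div_iff hs₁]
    have : ((8 * s : ℕ) : ℝ) ≤ m := by
      push_cast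
      linarith
    exact_mod_cast this
  obtain ⟨N, hN⟩ : ∃ N, m / (8 * s) = N + 1 := ⟨_, (Nat.sub_add_cancel hN').symm⟩
  have hgroups : m / 4 + 2 * s * (N + 1) ≤ m := by
    have h₁ : m / 4 * 4 ≤ m := Nat.div_mul_le_self _ _
    have h₂ : m / (8 * s) * (8 * s) ≤ m := Nat.div_mul_le_self _ _
    have h₃ : m / (8 * s) * (8 * s) = 4 * (2 * s * (m / (8 * s))) := by ring
    rw [← hN]
    omega
  have hN₁ : x / (16 * s) ≤ N := by
    have := Nat.lt_div_mul_add (a := m) (b := 8 * s) hs₁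
    rw [hN] at this
    have : (m : ℝ) < (N + 1) * (8 * s) + 8 * s := by exact_mod_cast this
    rw [div_le_iff₀ (by linarith)]
    linarith
  have hN₂ : (N : ℝ) ≤ x := by
    have : N ≤ m := by
      have := Nat.div_le_self m (8 * s)
      omega
    rw [← hx]
    exact_mod_cast this
  generalize m / 4 = Q at *
  -- As many rounds as the bound on the total number of hits permits.
  set R := N * Q / (128 * s * cap) with hR
  have hNQ : x / (16 * s) * (x / 8) ≤ N * Q :=
    mul_le_mul hN₁ hQ₁ (by linarith) (by positivity)
  have hR₂ : (R : ℝ) ≤ x ^ 2 / 4 := by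
    have : R ≤ N * Q := Nat.div_le_self _ _
    have : (R : ℝ) ≤ N * Q := by exact_mod_cast this
    have := mul_le_mul hN₂ hQ₂ (Nat.cast_nonneg Q) (by linarith)
    linarith
  have h₀ : 2 * x ≤ x ^ 2 / (2 * (409600 * (s : ℝ) ^ 2) * L) := by
    rw [le_div_iff₀ (by positivity)]
    have := mul_le_mul_of_nonneg_left hmL (by linarith : 0 ≤ x)
    linarith
  have hR₁ : x ^ 2 / (2 * (409600 * (s : ℝ) ^ 2) * L) ≤ R := by
    have hlt := Nat.lt_div_mul_add (a := N * Q) (b := 128 * s * cap) (by positivity)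
    rw [← hR] at hlt
    have hlt : (N : ℝ) * Q < R * (128 * s * cap) + 128 * s * cap := by exact_mod_cast hlt
    have h₂ : (R + 1 : ℝ) * (128 * s * cap) ≤ (R + 1) * (128 * s * (25 * L)) := by gcongr
    -- Here `409600 = 128 * (128 * 25)`; the extra factor `2` in the final bound absorbs the
    -- rounding term `+ 1`.
    have h₃ : x ^ 2 / (409600 * (s : ℝ) ^ 2 * L) ≤ R + 1 := by
      rw [div_le_iff₀ (by positivity)]
      have h₄ : x / (16 * s) * (x / 8) = x ^ 2 / (128 * s) := by
        field_simp
        ring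
      rw [h₄] at hNQ
      have h₅ : x ^ 2 / (128 * s) ≤ (R + 1) * (128 * s * (25 * L)) := by linarith
      rw [div_le_iff₀ (by positivity)] at h₅
      linarith
    have h₇ : x ^ 2 / (409600 * (s : ℝ) ^ 2 * L) =
        2 * (x ^ 2 / (2 * (409600 * (s : ℝ) ^ 2) * L)) := by
      field_simp
    linarith
  exact ⟨Q, N, R, hQ₁, hgroups, Nat.div_mul_le_self _ _, hR₂, h₀.trans hR₁, hR₁⟩

/-- Half of the saving `x ^ (-ε)` in `T` absorbs the logarithm in `cap`, and the other half remains;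
`800 = 8 * 2 * 2 * 25` collects the constants. -/
theorem two_mul_cap_le {x ε L T cap Q : ℝ} (hx : 1 ≤ x) (hL : 1 ≤ L) (hT₀ : 0 ≤ T)
    (hT : T ≤ 2 * x ^ (1 - ε)) (hcap : cap ≤ 25 * L) (hLx : 800 * L ≤ x ^ (ε / 2))
    (hQ : x / 8 ≤ Q) : 2 * T * cap ≤ Q * x ^ (-(ε / 2)) := by
  have hx' : 0 < x := by linarith
  have h₁ : x ^ (1 - ε) * x ^ (ε / 2) = x * x ^ (-(ε / 2)) := by
    calc x ^ (1 - ε) * x ^ (ε / 2) = x ^ (1 + -(ε / 2)) := by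
          rw [← Real.rpow_add hx']
          congr 1
          ring
      _ = _ := by rw [Real.rpow_add hx', Real.rpow_one]
  calc 2 * T * cap ≤ 2 * T * (25 * L) := by gcongr
    _ ≤ 2 * (2 * x ^ (1 - ε)) * (25 * L) := by gcongr
    _ = x ^ (1 - ε) * (800 * L) / 8 := by ring
    _ ≤ x ^ (1 - ε) * x ^ (ε / 2) / 8 := by gcongr
    _ = x / 8 * x ^ (-(ε / 2)) := by rw [h₁]; ring
    _ ≤ _ := by gcongr

theorem exp_div_two_pow_le {L : ℝ} {cap : ℕ} (hL : 0 ≤ L) (hcap : 24 * L ≤ cap) :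
    Real.exp (8 * L) / 2 ^ cap ≤ 2 * Real.exp (-(4 * L)) := by
  have h₁ : Real.exp (12 * L) ≤ 2 ^ cap := by
    rw [← Real.rpow_natCast, Real.rpow_def_of_pos two_pos]
    refine Real.exp_le_exp.2 ?_
    have h₂ : 1 / 2 ≤ Real.log 2 := by linarith [Real.log_two_gt_d9]
    have := mul_le_mul h₂ hcap (by linarith) (by linarith)
    linarith
  rw [div_le_iff₀ (by positivity)]
  have h₂ : Real.exp (8 * L) = Real.exp (-(4 * L)) * Real.exp (12 * L) := by
    rw [← Real.exp_add]
    congr 1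
    ring
  have h₃ := Real.exp_pos (-(4 * L))
  rw [h₂]
  have h₄ := mul_le_mul_of_nonneg_left h₁ h₃.le
  have h₅ : 0 ≤ Real.exp (-(4 * L)) * 2 ^ cap := by positivity
  linarith

/-- Constantly many slots suffice, as `q` need only be at least `6 / ε`. A threshold of `8 * L` and
a cap near `24 * L`, with `L = log m`, push deviations down to order `m ^ (-4)` per round, against
at most `m ^ 2 / 4` rounds. -/
theorem exists_isFeasible (ε : ℝ) (hε : 0 < ε) : ∃ m₀ : ℕ, ∃ c : ℝ, 0 < c ∧
    ∀ m ≥ m₀, ∀ T : ℕ, 1 ≤ T → (T : ℝ) ≤ 2 * (m : ℝ) ^ (1 - ε) →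
      1 ≤ Real.log m ∧ ∃ s q Q N cap P R θ δ, IsFeasible m T s q Q N cap P R θ δ ∧
        c * ((m : ℝ) ^ 2 / Real.log m) ≤ R / 2 := by
  obtain ⟨q, hq₀, hqε⟩ : ∃ q : ℕ, 0 < q ∧ 6 ≤ q * ε :=
    ⟨⌈6 / ε⌉₊, Nat.ceil_pos.2 (by positivity), (div_le_iff₀ hε).1 (Nat.le_ceil _)⟩
  obtain ⟨s, hs⟩ : ∃ s, s = 3 * q := ⟨_, rfl⟩
  have hs₀ : 0 < s := by omega
  have hs₁ : (1 : ℝ) ≤ s := by exact_mod_cast hs₀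
  have hs₂ : (s : ℝ) ≤ s ^ 2 := le_self_pow₀ hs₁ (by norm_num)
  have h2s : (0 : ℝ) < 16 * 2 ^ s := by positivity
  obtain ⟨m₀, hm₀⟩ := Filter.eventually_atTop.1
    (eventually_large ε hε (4 * (409600 * (s : ℝ) ^ 2) + 16 * 2 ^ s))
  refine ⟨m₀, 1 / (4 * (409600 * (s : ℝ) ^ 2)), by positivity, fun m hm T hT hTm => ?_⟩
  obtain ⟨hKx, hL, hLx, hKL⟩ := hm₀ m hm
  obtain ⟨L, hLdef⟩ : ∃ L, L = Real.log m := ⟨_, rfl⟩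
  rw [← hLdef] at hL hLx hKL ⊢
  have hx₀ : (1 : ℝ) ≤ m := by linarith
  have hexpL : Real.exp L = m := by rw [hLdef, Real.exp_log (by linarith)]
  obtain ⟨cap, hcap₁, hcap₂⟩ : ∃ cap : ℕ, 24 * L ≤ cap ∧ (cap : ℝ) ≤ 25 * L := by
    refine ⟨⌈24 * L⌉₊, Nat.le_ceil _, ?_⟩
    have := (Nat.ceil_lt_add_one (by linarith : 0 ≤ 24 * L)).le
    linarith
  have hcap₀ : 0 < cap := by
    have : (0 : ℝ) < cap := by linarith
    exact_mod_cast this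
  have hmL : 4 * (409600 * (s : ℝ) ^ 2) * L ≤ m := by
    have : 0 ≤ 16 * 2 ^ s * L := by positivity
    linarith
  obtain ⟨Q, N, R, hQ, hgroups, hRle, hR₂, hR₃, hR₁⟩ :=
    rounds_bounds hs₀ hcap₀ hL hcap₂ (by linarith) hmL
  have hTR : T ≤ R := by
    have : (m : ℝ) ^ (1 - ε) ≤ (m : ℝ) ^ (1 : ℝ) :=
      Real.rpow_le_rpow_of_exponent_le hx₀ (by linarith)
    rw [Real.rpow_one] at this
    have : (T : ℝ) ≤ R := by linarith
    exact_mod_cast this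
  -- Just enough phases to avoid a wrap-around before round `R`.
  obtain ⟨P, hP⟩ : ∃ P, P = (R + T) / (2 * T) + 1 := ⟨_, rfl⟩
  have hPR : P ≤ R + 1 := by
    have : (R + T) / (2 * T) ≤ R := by
      apply Nat.div_le_of_le_mul
      have : 2 * R ≤ 2 * T * R := Nat.mul_le_mul_right R (by omega)
      omega
    omega
  have hPT : P * T ≤ 2 * R := by
    have h₁ := Nat.div_mul_le_self (R + T) (2 * T)
    have h₂ : P * T * 2 = (R + T) / (2 * T) * (2 * T) + 2 * T := by
      rw [hP]
      ring
    omega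
  refine ⟨hL, s, q, Q, N, cap, P, R, 8 * L, 2 * Real.exp (-(4 * L)),
    { groups := hgroups
      q_pos := hq₀
      three_mul_le := hs.ge
      cap_pos := hcap₀
      pools_pos := ?_
      phases := by omega
      phase_hits := ?_
      total_hits := ?_
      lower_tail := ?_
      upper_tail := exp_div_two_pow_le (by linarith) hcap₁
      failure := ?_ }, ?_⟩
  · have : (0 : ℝ) < Q := by linarith
    exact_mod_cast this
  · have hY : (16 * P * 2 ^ s : ℝ) ≤ (m : ℝ) ^ 3 := by
      have h₁ : (P : ℝ) ≤ (m : ℝ) ^ 2 := by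
        have h₂ : (P : ℝ) ≤ R + 1 := by exact_mod_cast hPR
        have h₃ : (4 : ℝ) ≤ m := by linarith
        have h₄ := mul_le_mul h₃ h₃ (by norm_num) (by linarith)
        linarith
      have h₂ : 16 * (2 : ℝ) ^ s ≤ m := by linarith
      calc (16 * P * 2 ^ s : ℝ) = (16 * 2 ^ s) * P := by ring
        _ ≤ m * (m : ℝ) ^ 2 := mul_le_mul h₂ h₁ (by positivity) (by positivity)
        _ = (m : ℝ) ^ 3 := by ring
    have := mul_pow_le_pow_of_rpow hx₀ (by positivity) (by positivity) hqε
      (two_mul_cap_le hx₀ hL (Nat.cast_nonneg T) hTm hcap₂ hLx hQ) hY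
    exact_mod_cast this
  · calc 64 * s * P * T * cap = 64 * s * cap * (P * T) := by ring
      _ ≤ 64 * s * cap * (2 * R) := Nat.mul_le_mul_left _ hPT
      _ = R * (128 * s * cap) := by ring
      _ ≤ _ := hRle
  · rw [show -(8 * L) / 2 = -(4 * L) by ring]
  · have h₁ : Real.exp (-(4 * L)) = ((m : ℝ) ^ 4)⁻¹ := by
      rw [Real.exp_neg, ← hexpL, ← Real.exp_nat_mul]
      norm_num
    rw [h₁]
    calc (R : ℝ) * (2 * ((m : ℝ) ^ 4)⁻¹) ≤ (m : ℝ) ^ 2 / 4 * (2 * ((m : ℝ) ^ 4)⁻¹) := by gcongr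
      _ = 1 / (2 * (m : ℝ) ^ 2) := by
        field_simp
        norm_num
      _ ≤ 1 / 4 := by
        apply one_div_le_one_div_of_le (by norm_num)
        have h₃ : (4 : ℝ) ≤ m := by linarith
        have h₄ := mul_le_mul h₃ h₃ (by norm_num) (by linarith)
        linarith
  · calc 1 / (4 * (409600 * (s : ℝ) ^ 2)) * ((m : ℝ) ^ 2 / L) =
          (m : ℝ) ^ 2 / (2 * (409600 * (s : ℝ) ^ 2) * L) / 2 := by
          field_simp
          ring
      _ ≤ (R : ℝ) / 2 := by gcongr

end RadioBroadcast

/-! ### The lower bound -/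

theorem theorem2 (ε : ℝ) (hε : 0 < ε) :
    ∃ c : ℝ, 0 < c ∧ ∀ n k T : ℕ, 1 ≤ k → k < n → 1 ≤ T →
      (T : ℝ) ≤ ((n : ℝ) / (k : ℝ)) ^ (1 - ε) →
      ∀ (S C M : Type*) [MeasurableSpace S] [MeasurableSpace C] [MeasurableSpace M]
        (𝒜 : RadioBroadcast.Algorithm n S C M) (source : Fin n),
        ∃ A : RadioBroadcast.ObliviousAdversary 1 n C,
          A.IsIntervalConnected T k ∧
          ENNReal.ofReal (c * ((n : ℝ) ^ 2 / ((k : ℝ) ^ 2 * Real.log n))) ≤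
            𝒜.expectedBroadcastTime source A := by
  obtain ⟨m₀, c, hc, hfeas⟩ := RadioBroadcast.exists_isFeasible ε hε
  have hlog2 : 0 < Real.log 2 := Real.log_pos one_lt_two
  -- The factor `1 / 4` pays for replacing `n / k` by its integer part, at least half as large. The
  -- second term makes the bound at most `1` when the integer part is below `m₀`, where the trivial
  -- bound of one round suffices.
  refine ⟨min (c / 4) (Real.log 2 / (m₀ + 1) ^ 2), by positivity, ?_⟩
  intro n k T hk hkn hT hTn S C M _ _ _ 𝒜 source
  have hn : 2 ≤ n := by omega
  have hkr : (0 : ℝ) < k := by exact_mod_cast hk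
  have hknr : (k : ℝ) < n := by exact_mod_cast hkn
  have hone : 1 < (n : ℝ) / k := (one_lt_div hkr).2 hknr
  have hlogn : Real.log 2 ≤ Real.log n := Real.log_le_log two_pos (by exact_mod_cast hn)
  have hm : 1 ≤ n / k := (Nat.one_le_div_iff (by omega)).2 hkn.le
  have hdiv : (n : ℝ) / k ≤ (n / k : ℕ) + 1 := by
    have := Nat.lt_div_mul_add (a := n) (b := k) (by omega)
    rw [div_le_iff₀ hkr, add_mul, one_mul]
    exact_mod_cast this.le
  have heq : (n : ℝ) ^ 2 / ((k : ℝ) ^ 2 * Real.log n) = ((n : ℝ) / k) ^ 2 / Real.log n := by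
    rw [div_pow, div_div]
  rw [heq]
  have hpos : 0 ≤ ((n : ℝ) / k) ^ 2 / Real.log n :=
    div_nonneg (by positivity) (hlog2.le.trans hlogn)
  rcases le_or_gt m₀ (n / k) with hlarge | hsmall
  -- For `ε > 1` the upper bound on `T` is below `1`.
  · have hε₁ : ε ≤ 1 := by
      by_contra hc
      have h₁ : ((n : ℝ) / k) ^ (1 - ε) < 1 :=
        Real.rpow_lt_one_of_one_lt_of_neg hone (by linarith)
      have h₂ : (1 : ℝ) ≤ T := by exact_mod_cast hT
      linarith
    have hmr : (1 : ℝ) ≤ (n / k : ℕ) := by exact_mod_cast hm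
    have hdiv₂ : (n : ℝ) / k ≤ 2 * (n / k : ℕ) := by linarith
    have hTm : (T : ℝ) ≤ 2 * ((n / k : ℕ) : ℝ) ^ (1 - ε) := by
      calc (T : ℝ) ≤ (2 * (n / k : ℕ) : ℝ) ^ (1 - ε) :=
            hTn.trans (Real.rpow_le_rpow (by positivity) hdiv₂ (by linarith))
        _ = 2 ^ (1 - ε) * ((n / k : ℕ) : ℝ) ^ (1 - ε) :=
            Real.mul_rpow (by norm_num) (by positivity)
        _ ≤ 2 ^ (1 : ℝ) * ((n / k : ℕ) : ℝ) ^ (1 - ε) := by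
            gcongr
            · norm_num
            · linarith
        _ = _ := by rw [Real.rpow_one]
    obtain ⟨hL, s, q, Q, N, cap, P, R, θ, δ, hF, hR⟩ := hfeas _ hlarge T hT hTm
    obtain ⟨A, hA, hE⟩ := RadioBroadcast.exists_adversary hk hkn hT (Nat.div_mul_le_self n k) hF
      𝒜 source
    refine ⟨A, hA, le_trans (ENNReal.ofReal_le_ofReal ?_) hE⟩
    have hlogm : Real.log (n / k : ℕ) ≤ Real.log n :=
      Real.log_le_log (by linarith) (by exact_mod_cast Nat.div_le_self n k)
    calc min (c / 4) (Real.log 2 / (m₀ + 1) ^ 2) * (((n : ℝ) / k) ^ 2 / Real.log n)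
        ≤ c / 4 * ((2 * (n / k : ℕ)) ^ 2 / Real.log (n / k : ℕ)) := by
          gcongr
          exact min_le_left _ _
      _ = c * (((n / k : ℕ) : ℝ) ^ 2 / Real.log (n / k : ℕ)) := by ring
      _ ≤ R / 2 := hR
  · refine ⟨RadioBroadcast.completeAdversary n C,
      RadioBroadcast.isIntervalConnected_completeAdversary C hkn T,
      le_trans ?_ (RadioBroadcast.one_le_expectedBroadcastTime hn 𝒜 source _)⟩
    rw [ENNReal.ofReal_le_one]
    have hsm : (n : ℝ) / k ≤ m₀ + 1 := by
      have : ((n / k : ℕ) : ℝ) ≤ m₀ := by exact_mod_cast hsmall.le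
      linarith
    calc min (c / 4) (Real.log 2 / (m₀ + 1) ^ 2) * (((n : ℝ) / k) ^ 2 / Real.log n)
        ≤ Real.log 2 / (m₀ + 1) ^ 2 * ((m₀ + 1) ^ 2 / Real.log 2) := by
          gcongr
          exact min_le_right _ _
      _ = 1 := by field_simp
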